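/- Let $r\ge 1$ and $n=2r$. Let $C_n$ be the real Clifford algebra with generators $e_1,\dots,e_n$ and relations $e_i^2=-1$, $e_ie_j=-e_je_i$ for $i\neq j$; let $\mathrm{Spin}(n)\subset C_n$ be the spin group, with $\rho\colon\mathrm{Spin}(n)\to SO(n)$, $\rho(g)v=gvg^{-1}$ for $v\in\mathbb R^n=\mathrm{span}(e_1,\dots,e_n)$, and let $\mathrm{Spin}^c(n)=(\mathrm{Spin}(n)\times U(1))/\{\pm(1,1)\}$, which maps to $C_n\otimes\mathbb C$ by $[g,\lambda]\mapsto \lambda g$. Define $2^r\times 2^r$ complex matrices $E_1,\dots,E_{2r+1}$ recursively: for $r=0$, $E_1=[-i]$; and from $E_1,\dots,E_{2r+1}$ of size $2^r$ one obtains the matrices of size $2^{r+1}$ $$\widetilde E_j=\begin{bmatrix}0&E_j\\E_j&0\end{bmatrix}\ (1\le j\le 2r+1),\qquad \widetilde E_{2r+2}=\begin{bmatrix}0&-I\\I&0\end{bmatrix},\qquad \widetilde E_{2r+3}=\begin{bmatrix}-iI&0\\0&iI\end{bmatrix}.$$ The spin representation of $\mathrm{Spin}^c(2r)$ on $\mathbb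 C^{2^r}$ is the composition of $\mathrm{Spin}^c(2r)\to C_{2r}\otimes\mathbb C$ with the algebra homomorphism $c\colon C_{2r}\otimes\mathbb C\to M_{2^r}(\mathbb C)$, $c(e_j)=E_j$ $(1\le j\le 2r)$. Identify $\mathbb C^r$ with $\mathbb R^{2r}$ by $(z_1,\dots,z_r)\mapsto(x_1,y_1,\dots,x_r,y_r)$, $z_j=x_j+iy_j$, and let $j\colon U(r)\to SO(2r)$ be the induced homomorphism. Then there is a unique homomorphism $\tilde l\colon U(r)\to\mathrm{Spin}^c(2r)$ that lifts $$l\colon U(r)\to SO(2r)\times U(1),\qquad l(g)=(j(g),\det g),$$ through the homomorphism $\mathrm{Spin}^c(2r)\to SO(2r)\times U(1)$, $[g,\lambda]\mapsto(\rho(g),\lambda^2)$, and $\tilde l$ is continuous. The representation of $U(r)$ on $\mathbb C^{2^r}$ obtained by composing this canonical map $\tilde l$ with the spin representation of $\mathrm{Spin}^c(2r)$ is unitary, and it is unitarily equivalent to the standard (unitary) representation of $U(r)$ on $\Lambda^\bullet\mathbb C^r$, $g(v_1\wedge\dots\wedge v_p)=gv_1\wedge\dots\wedge gv_p$, where $\Lambda^\bullet\mathbb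 C^r$ carries the Hermitian inner product for which the elements $e_{i_1}\wedge\dots\wedge e_{i_p}$, $i_1<\dots<i_p$, formed from the standard basis of $\mathbb C^r$, are orthonormal. -/

import Mathlib

open scoped TensorProduct ComplexConjugate

noncomputable section

namespace SpinorRep

/-! ### The Clifford algebra and the groups `Spin(n)`, `Spin^c(n)` -/

/-- The quadratic form `x ↦ -(x₁² + ⋯ + xₙ²)` on `ℝⁿ`. -/
def negForm (n : ℕ) : QuadraticForm ℝ (Fin n → ℝ) :=
  QuadraticMap.weightedSumSquares ℝ (fun _ => (-1 : ℝ))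

/-- The real Clifford algebra `Cₙ`: generators `e₁, …, eₙ` with `eᵢ² = -1`, `eᵢ eⱼ = - eⱼ eᵢ`. -/
abbrev Cliff (n : ℕ) : Type := CliffordAlgebra (negForm n)

/-- The usual topology of the finite dimensional real vector space `Cₙ`. -/
instance cliffTopology (n : ℕ) : TopologicalSpace (Cliff n) := moduleTopology ℝ (Cliff n)

/-- The compact group `Spin(n) ⊂ Cₙ`. -/
abbrev Spin (n : ℕ) : Type := spinGroup (negForm n)

/-- The linear projection of `Cₙ` onto the vectors `ℝⁿ`. -/
def vecPart (n : ℕ) : Cliff n →ₗ[ℝ] (Fin n → ℝ) :=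
  (ExteriorAlgebra.ιInv : ExteriorAlgebra ℝ (Fin n → ℝ) →ₗ[ℝ] (Fin n → ℝ)) ∘ₗ
    (CliffordAlgebra.equivExterior (negForm n)).toLinearMap

theorem vecPart_ι (n : ℕ) (v : Fin n → ℝ) :
    vecPart n (CliffordAlgebra.ι (negForm n) v) = v := by
  simp only [vecPart, LinearMap.comp_apply, LinearEquiv.coe_coe]
  rw [CliffordAlgebra.equivExterior]
  have h : CliffordAlgebra.changeForm (Q := negForm n) (Q' := 0)
      CliffordAlgebra.changeForm.associated_neg_proof (CliffordAlgebra.ι (negForm n) v) =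
      ExteriorAlgebra.ι ℝ v := CliffordAlgebra.changeForm_ι _ v
  exact (congrArg _ h).trans (ExteriorAlgebra.ι_leftInverse (R := ℝ) v)

theorem ι_vecPart_conj {n : ℕ} (g : Spin n) (v : Fin n → ℝ) :
    CliffordAlgebra.ι (negForm n)
      (vecPart n ((g : Cliff n) * CliffordAlgebra.ι (negForm n) v * (g⁻¹ : Spin n))) =
      (g : Cliff n) * CliffordAlgebra.ι (negForm n) v * (g⁻¹ : Spin n) := by
  have h := spinGroup.conjAct_smul_ι_mem_range_ι (Q := negForm n) (x := spinGroup.toUnits g) g.2 v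
  obtain ⟨w, hw⟩ := h
  have hw' : CliffordAlgebra.ι (negForm n) w =
      (g : Cliff n) * CliffordAlgebra.ι (negForm n) v * (g⁻¹ : Spin n) := by
    rw [hw]; rfl
  rw [← hw', vecPart_ι]

/-- `ρ : Spin(n) → SO(n) ⊂ End(ℝⁿ)`, `ρ(g) v = g v g⁻¹`. -/
def rho (n : ℕ) : Spin n →* Module.End ℝ (Fin n → ℝ) where
  toFun g := vecPart n ∘ₗ LinearMap.mulRight ℝ ((g⁻¹ : Spin n) : Cliff n) ∘ₗ
    LinearMap.mulLeft ℝ (g : Cliff n) ∘ₗ CliffordAlgebra.ι (negForm n)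
  map_one' := by
    refine LinearMap.ext fun v => ?_
    simp [vecPart_ι]
  map_mul' g h := by
    refine LinearMap.ext fun v => ?_
    simp only [Module.End.mul_apply, LinearMap.comp_apply, LinearMap.mulLeft_apply,
      LinearMap.mulRight_apply]
    rw [ι_vecPart_conj h v]
    simp [mul_assoc]

/-- The vector `ρ(g) v`, seen in the Clifford algebra, is `g v g⁻¹`. -/
theorem ι_rho {n : ℕ} (g : Spin n) (v : Fin n → ℝ) :
    CliffordAlgebra.ι (negForm n) (rho n g v) =
      (g : Cliff n) * CliffordAlgebra.ι (negForm n) v * (g⁻¹ : Spin n) :=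
  ι_vecPart_conj g v

/-- The subgroup `{(1, 1), (-1, -1)}` of `Spin(n) × U(1)`. -/
def signSubgroup (n : ℕ) : Subgroup (Spin n × Circle) where
  carrier := {p | ((p.1 : Cliff n) = 1 ∧ (p.2 : ℂ) = 1) ∨ ((p.1 : Cliff n) = -1 ∧ (p.2 : ℂ) = -1)}
  one_mem' := by simp
  mul_mem' := by
    rintro a b (⟨ha, ha'⟩ | ⟨ha, ha'⟩) (⟨hb, hb'⟩ | ⟨hb, hb'⟩) <;>
      simp only [Set.mem_ofPred_eq, Prod.fst_mul, Prod.snd_mul, Submonoid.coe_mul, Circle.coe_mul,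
        ha, ha', hb, hb'] <;> simp
  inv_mem' := by
    rintro a (⟨ha, ha'⟩ | ⟨ha, ha'⟩)
    · left
      refine ⟨?_, by simp [ha']⟩
      change star (a.1 : Cliff n) = 1
      rw [ha, star_one]
    · right
      refine ⟨?_, by simp [ha']⟩
      change star (a.1 : Cliff n) = -1
      rw [ha, star_neg, star_one]

instance signSubgroup_normal (n : ℕ) : (signSubgroup n).Normal where
  conj_mem := by
    intro a ha g
    have h1 : (g.1 : Cliff n) * ((g.1⁻¹ : Spin n) : Cliff n) = 1 := by
      exact congrArg (fun x : Spin n => (x : Cliff n)) (mul_inv_cancel g.1)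
    rcases ha with ⟨ha, ha'⟩ | ⟨ha, ha'⟩
    · left; constructor
      · simp [ha, h1]
      · simp [ha']
    · right; constructor
      · simp [ha, h1]
      · simp [ha']

/-- `Spin^c(n) = Spin(n) ×_{ℤ/2} U(1)`, with the quotient topology. -/
abbrev SpinC (n : ℕ) : Type := (Spin n × Circle) ⧸ signSubgroup n

/-- The inclusion `Spin^c(n) → Cₙ ⊗ ℂ`, `[g, λ] ↦ λ g`. -/
def spinCInclusion (n : ℕ) : SpinC n →* ℂ ⊗[ℝ] Cliff n :=
  QuotientGroup.lift (signSubgroup n)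
    { toFun := fun p => (p.2 : ℂ) ⊗ₜ[ℝ] (p.1 : Cliff n)
      map_one' := by simp [Algebra.TensorProduct.one_def]
      map_mul' := fun p q => by simp }
    (by
      rintro p (⟨h, h'⟩ | ⟨h, h'⟩)
      · change (p.2 : ℂ) ⊗ₜ[ℝ] (p.1 : Cliff n) = 1
        rw [h, h', Algebra.TensorProduct.one_def]
      · change (p.2 : ℂ) ⊗ₜ[ℝ] (p.1 : Cliff n) = 1
        rw [h, h', TensorProduct.neg_tmul, TensorProduct.tmul_neg, neg_neg,
          Algebra.TensorProduct.one_def])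

/-- The homomorphism `Spin^c(n) → SO(n) × U(1)`, `[g, λ] ↦ (ρ(g), λ²)`,
with `SO(n)` regarded inside `End(ℝⁿ)`. -/
def spinCCover (n : ℕ) : SpinC n →* Module.End ℝ (Fin n → ℝ) × Circle :=
  QuotientGroup.lift (signSubgroup n)
    { toFun := fun p => (rho n p.1, p.2 ^ 2)
      map_one' := by simp
      map_mul' := fun p q => by simp [mul_pow] }
    (by
      rintro p (⟨h, h'⟩ | ⟨h, h'⟩)
      · have e1 : p.1 = 1 := Subtype.ext h
        have e2 : p.2 = 1 := Circle.ext h'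
        simp [e1, e2]
      · have e2 : p.2 ^ 2 = 1 := Circle.ext (by simp [h'])
        have e3 : ((p.1⁻¹ : Spin n) : Cliff n) = -1 := by
          change star (p.1 : Cliff n) = -1
          rw [h, star_neg, star_one]
        have e1 : rho n p.1 = 1 := by
          refine LinearMap.ext fun v => ?_
          change vecPart n ((p.1 : Cliff n) * CliffordAlgebra.ι (negForm n) v *
            ((p.1⁻¹ : Spin n) : Cliff n)) = v
          rw [h, e3]
          simp [vecPart_ι]
        simp [e1, e2])

/-! ### The spin representation -/

/-- The identification `{1, …, 2^r} ⊔ {1, …, 2^r} ≃ {1, …, 2^(r+1)}` used for block matrices. -/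
def blockEquiv (r : ℕ) : Fin (2 ^ r) ⊕ Fin (2 ^ r) ≃ Fin (2 ^ (r + 1)) :=
  finSumFinEquiv.trans (finCongr (by ring))

/-- A `2 × 2` block matrix with blocks of size `2^r`, as a matrix of size `2^(r+1)`. -/
def block (r : ℕ) (A B C D : Matrix (Fin (2 ^ r)) (Fin (2 ^ r)) ℂ) :
    Matrix (Fin (2 ^ (r + 1))) (Fin (2 ^ (r + 1))) ℂ :=
  Matrix.reindex (blockEquiv r) (blockEquiv r) (Matrix.fromBlocks A B C D)

/-- The matrices of size `2^r`: `diracMatrix r j` is `E_{j+1}`, for `j = 0, …, 2r`. The first `2r`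
of them are the matrices for `n = 2r`, and all `2r + 1` of them those for `n = 2r + 1`
(values at `j > 2r` are irrelevant). -/
def diracMatrix : (r : ℕ) → ℕ → Matrix (Fin (2 ^ r)) (Fin (2 ^ r)) ℂ
  | 0, _ => -Complex.I • 1
  | r + 1, j =>
      if j < 2 * r + 1 then block r 0 (diracMatrix r j) (diracMatrix r j) 0
      else if j = 2 * r + 1 then block r 0 (-1) 1 0
      else block r (-Complex.I • 1) 0 0 (Complex.I • 1)

theorem block_mul (r : ℕ) (A B C D A' B' C' D' : Matrix (Fin (2 ^ r)) (Fin (2 ^ r)) ℂ) :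
    block r A B C D * block r A' B' C' D' =
      block r (A * A' + B * C') (A * B' + B * D') (C * A' + D * C') (C * B' + D * D') := by
  simp only [block, Matrix.reindex_apply, Matrix.submatrix_mul_equiv, Matrix.fromBlocks_multiply]

theorem block_add (r : ℕ) (A B C D A' B' C' D' : Matrix (Fin (2 ^ r)) (Fin (2 ^ r)) ℂ) :
    block r A B C D + block r A' B' C' D' =
      block r (A + A') (B + B') (C + C') (D + D') := by
  simp only [block, Matrix.reindex_apply, ← Matrix.fromBlocks_add]
  rfl

theorem block_neg_one (r : ℕ) : block r (-1) 0 0 (-1) = -1 := by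
  have : Matrix.fromBlocks (-1 : Matrix (Fin (2 ^ r)) (Fin (2 ^ r)) ℂ) 0 0
      (-1 : Matrix (Fin (2 ^ r)) (Fin (2 ^ r)) ℂ) = -1 := by
    rw [← Matrix.fromBlocks_one, Matrix.fromBlocks_neg]; simp
  rw [block, this, Matrix.reindex_apply, Matrix.submatrix_neg]
  simp

theorem block_zero (r : ℕ) : block r 0 0 0 0 = 0 := by
  simp [block, Matrix.fromBlocks_zero]

theorem diracMatrix_sq (r j : ℕ) : diracMatrix r j * diracMatrix r j = -1 := by
  induction r with
  | zero => simp [diracMatrix, smul_smul]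
  | succ r ih =>
    rw [diracMatrix]
    split_ifs
    · simp [block_mul, ih, block_neg_one]
    · simp [block_mul, block_neg_one]
    · simp [block_mul, smul_smul, block_neg_one]

theorem diracMatrix_anticomm (r : ℕ) : ∀ j k : ℕ, j < k → k < 2 * r + 1 →
    diracMatrix r j * diracMatrix r k + diracMatrix r k * diracMatrix r j = 0 := by
  induction r with
  | zero => intro j k h h'; omega
  | succ r ih =>
    intro j k h h'
    rw [diracMatrix, diracMatrix]
    by_cases hk : k < 2 * r + 1
    · have hj : j < 2 * r + 1 := by omega
      simp [hk, hj, block_mul, block_add, ih j k h hk, block_zero]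
    · by_cases hk2 : k = 2 * r + 1
      · have hj : j < 2 * r + 1 := by omega
        simp [hk2, hj, block_mul, block_add, block_zero]
      · by_cases hj : j < 2 * r + 1
        · simp [hk2, hk, hj, block_mul, block_add, block_zero]
        · have hj2 : j = 2 * r + 1 := by omega
          simp [hk2, hk, hj2, block_mul, block_add, block_zero]

/-- `c(v) = ∑ⱼ vⱼ Eⱼ` for `v ∈ ℝ^{2r}`. -/
def cliffordMap (r : ℕ) : (Fin (2 * r) → ℝ) →ₗ[ℝ] Matrix (Fin (2 ^ r)) (Fin (2 ^ r)) ℂ :=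
  Fintype.linearCombination ℝ (fun j : Fin (2 * r) => diracMatrix r j)

theorem cliffordMap_sq (r : ℕ) (v : Fin (2 * r) → ℝ) :
    cliffordMap r v * cliffordMap r v = algebraMap ℝ _ (negForm (2 * r) v) := by
  have key : ∀ j k : Fin (2 * r), diracMatrix r j * diracMatrix r k +
      diracMatrix r k * diracMatrix r j = if j = k then (-2 : ℝ) • 1 else 0 := by
    intro j k
    split_ifs with h
    · subst h
      rw [diracMatrix_sq, ← two_smul ℝ, smul_neg, neg_smul]
    · rcases lt_or_gt_of_ne (fun e => h (Fin.ext e)) with h' | h'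
      · exact diracMatrix_anticomm r j k h' (by omega)
      · rw [add_comm]; exact diracMatrix_anticomm r k j h' (by omega)
  have e1 : cliffordMap r v * cliffordMap r v =
      ∑ j, ∑ k, (v j * v k) • (diracMatrix r j * diracMatrix r k) := by
    simp only [cliffordMap, Fintype.linearCombination_apply, Finset.sum_mul, Finset.mul_sum,
      smul_mul_smul_comm]
    exact Finset.sum_comm
  have e2 : (2 : ℝ) • (cliffordMap r v * cliffordMap r v) =
      (2 : ℝ) • algebraMap ℝ (Matrix (Fin (2 ^ r)) (Fin (2 ^ r)) ℂ) (negForm (2 * r) v) := by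
    calc (2 : ℝ) • (cliffordMap r v * cliffordMap r v)
        = ∑ j, ∑ k, (v j * v k) • (diracMatrix r j * diracMatrix r k +
            diracMatrix r k * diracMatrix r j) := by
          simp only [smul_add, Finset.sum_add_distrib]
          rw [two_smul, e1]
          congr 1
          rw [Finset.sum_comm]
          exact Finset.sum_congr rfl fun i _ => Finset.sum_congr rfl fun j _ => by rw [mul_comm]
      _ = _ := by
          simp only [key, smul_ite, smul_zero, Finset.sum_ite_eq, Finset.mem_univ, if_true,
            negForm, QuadraticMap.weightedSumSquares_apply, Algebra.algebraMap_eq_smul_one,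
            smul_smul, ← Finset.sum_smul]
          congr 1
          rw [Finset.mul_sum]
          exact Finset.sum_congr rfl fun i _ => by simp; ring
  exact smul_right_injective _ (two_ne_zero : (2 : ℝ) ≠ 0) e2

/-- The algebra homomorphism `c : C_{2r} ⊗ ℂ → M_{2^r}(ℂ)` with `c(eⱼ) = Eⱼ`. -/
def cliffordRep (r : ℕ) :
    ℂ ⊗[ℝ] Cliff (2 * r) →ₐ[ℂ] Matrix (Fin (2 ^ r)) (Fin (2 ^ r)) ℂ :=
  Algebra.TensorProduct.lift (Algebra.ofId ℂ _)
    (CliffordAlgebra.lift (negForm (2 * r)) ⟨cliffordMap r, cliffordMap_sq r⟩)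
    (fun z _ => Algebra.commutes z _)

/-- The spin representation of `Spin^c(2r)` on `ℂ^{2^r}`. -/
def spinRep (r : ℕ) : Representation ℂ (SpinC (2 * r)) (EuclideanSpace ℂ (Fin (2 ^ r))) :=
  (((Matrix.toLpLinAlgEquiv 2 : Matrix (Fin (2 ^ r)) (Fin (2 ^ r)) ℂ ≃ₐ[ℂ]
      Module.End ℂ (EuclideanSpace ℂ (Fin (2 ^ r)))).toAlgHom.comp (cliffordRep r) :
    ℂ ⊗[ℝ] Cliff (2 * r) →* Module.End ℂ (EuclideanSpace ℂ (Fin (2 ^ r))))).comp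
    (spinCInclusion (2 * r))

/-! ### The canonical homomorphism `U(r) → Spin^c(2r)` -/

/-- The unitary group `U(r)`. -/
abbrev U (r : ℕ) : Type := Matrix.unitaryGroup (Fin r) ℂ

/-- The identification `ℂ^r → ℝ^{2r}`, `(z₁, …, z_r) ↦ (x₁, y₁, …, x_r, y_r)`, `zⱼ = xⱼ + i yⱼ`. -/
def realCoords (r : ℕ) : (Fin r → ℂ) ≃ₗ[ℝ] (Fin (2 * r) → ℝ) where
  toFun z k := if (k : ℕ) % 2 = 0 then (z ⟨k / 2, by omega⟩).re else (z ⟨k / 2, by omega⟩).im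
  map_add' z w := by
    ext k; dsimp only [Pi.add_apply]; split_ifs <;> simp
  map_smul' a z := by
    ext k; dsimp only [Pi.smul_apply, RingHom.id_apply]; split_ifs <;> simp
  invFun x j := ⟨x ⟨2 * j, by omega⟩, x ⟨2 * j + 1, by omega⟩⟩
  left_inv z := by
    ext j
    have h : (2 * (j : ℕ) + 1) / 2 = j := by omega
    apply Complex.ext <;> simp [h, Nat.add_mod]
  right_inv x := by
    ext k
    dsimp only
    split_ifs with h
    · congr 1; ext; simp; omega
    · congr 1; ext; simp; omega

/-- The homomorphism `j : U(r) → SO(2r) ⊂ End(ℝ^{2r})` induced by the identification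
`ℂ^r = ℝ^{2r}`. -/
def realification (r : ℕ) : U r →* Module.End ℝ (Fin (2 * r) → ℝ) where
  toFun g := (realCoords r).conj ((Matrix.toLin' (g : Matrix (Fin r) (Fin r) ℂ)).restrictScalars ℝ)
  map_one' := by
    refine LinearMap.ext fun v => ?_
    simp [LinearEquiv.conj_apply]
  map_mul' g h := by
    refine LinearMap.ext fun v => ?_
    simp [LinearEquiv.conj_apply]

/-- The homomorphism `det : U(r) → U(1)`. -/
def detCircle (r : ℕ) : U r →* Circle where
  toFun g := ⟨(g : Matrix (Fin r) (Fin r) ℂ).det, by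
    have h := (Matrix.det_of_mem_unitary g.2)
    simpa [Submonoid.unitSphere] using CStarRing.norm_of_mem_unitary h⟩
  map_one' := by ext; simp
  map_mul' g h := Circle.ext (Matrix.det_mul _ _)

/-- `f : U(r) → Spin^c(2r)` is a lift of `l : U(r) → SO(2r) × U(1)`, `l(g) = (j(g), det g)`. -/
def IsLift (r : ℕ) (f : U r →* SpinC (2 * r)) : Prop :=
  ∀ g : U r, spinCCover (2 * r) (f g) = (realification r g, detCircle r g)

/-! ### The exterior algebra as a unitary representation -/

/-- The exterior algebra `Λ^• ℂ^r`. -/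
abbrev Lam (r : ℕ) : Type := ExteriorAlgebra ℂ (EuclideanSpace ℂ (Fin r))

/-- The basis `e_{i₁} ∧ ⋯ ∧ e_{i_p}`, `i₁ < ⋯ < i_p`, of `Λ^• ℂ^r`. -/
def lamBasis (r : ℕ) : Module.Basis (Finset (Fin r)) ℂ (Lam r) :=
  (EuclideanSpace.basisFun (Fin r) ℂ).toBasis.ExteriorAlgebra

/-- The standard Hermitian inner product on `Λ^• ℂ^r`, for which the basis
`e_{i₁} ∧ ⋯ ∧ e_{i_p}`, `i₁ < ⋯ < i_p`, is orthonormal. -/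
@[reducible]
def lamCore (r : ℕ) : InnerProductSpace.Core ℂ (Lam r) where
  inner x y := ∑ s, conj ((lamBasis r).repr x s) * (lamBasis r).repr y s
  conj_inner_symm x y := by simp [map_sum, mul_comm]
  re_inner_nonneg x := by
    rw [map_sum]
    exact Finset.sum_nonneg fun s _ => by
      rw [← Complex.normSq_eq_conj_mul_self]
      simpa using Complex.normSq_nonneg _
  add_left x y z := by simp [add_mul, Finset.sum_add_distrib]
  smul_left x y a := by simp [Finset.mul_sum, mul_assoc]
  definite x h := by
    have h' : ∑ s, Complex.normSq ((lamBasis r).repr x s) = 0 := by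
      simp only [← Complex.normSq_eq_conj_mul_self] at h
      exact_mod_cast h
    rw [Finset.sum_eq_zero_iff_of_nonneg fun s _ => Complex.normSq_nonneg _] at h'
    apply (lamBasis r).repr.injective
    ext s
    simpa using h' s (Finset.mem_univ s)

instance lamNormedAddCommGroup (r : ℕ) : NormedAddCommGroup (Lam r) :=
  (lamCore r).toNormedAddCommGroup

instance lamInnerProductSpace (r : ℕ) : InnerProductSpace ℂ (Lam r) :=
  InnerProductSpace.ofCore (lamCore r).toCore

/-- The standard representation of `U(r)` on `Λ^• ℂ^r`:
`g (v₁ ∧ ⋯ ∧ v_p) = g v₁ ∧ ⋯ ∧ g v_p`. -/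
def exteriorRep (r : ℕ) : Representation ℂ (U r) (Lam r) where
  toFun g := (ExteriorAlgebra.map
    (Matrix.toLpLin 2 2 (g : Matrix (Fin r) (Fin r) ℂ))).toLinearMap
  map_one' := by
    simp only [OneMemClass.coe_one, Matrix.toLpLin_one, ExteriorAlgebra.map_id]
    rfl
  map_mul' g h := by
    simp only [Submonoid.coe_mul, Matrix.toLpLin_mul_same, ← ExteriorAlgebra.map_comp_map]
    rfl

/-! ### Unitary equivalence -/

/-- A representation by isometries of an inner product space. -/
def IsUnitaryRep {G V : Type*} [Group G] [NormedAddCommGroup V] [InnerProductSpace ℂ V]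
    (π : Representation ℂ G V) : Prop :=
  ∀ (g : G) (x y : V), inner ℂ (π g x) (π g y) = inner ℂ x y

/-- Two unitary representations are unitarily equivalent if some surjective linear isometry
intertwines them. -/
def UnitarilyEquivalent {G V W : Type*} [Group G] [NormedAddCommGroup V] [InnerProductSpace ℂ V]
    [NormedAddCommGroup W] [InnerProductSpace ℂ W]
    (π : Representation ℂ G V) (σ : Representation ℂ G W) : Prop :=
  IsUnitaryRep π ∧ IsUnitaryRep σ ∧
    ∃ T : V ≃ₗᵢ[ℂ] W, ∀ (g : G) (v : V), T (π g v) = σ g (T v)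

end SpinorRep

end

noncomputable section

namespace SpinorRep

open Matrix

/-! ### Dirac matrices and the vacuum vector -/

/-! The spinor space is the fermionic Fock space of `ℂ^r`. The combinations `(E_{2k-1} - i
E_{2k})/2` and their adjoints are creation and annihilation operators satisfying the canonical
anticommutation relations (`creation_anticomm`, `annihilation_mul_creation`), and a vector acts on
spinors as creation minus annihilation. The annihilators kill the first basis vector, the vacuum.
Applying creation operators to it gives `fockMap`, which sends the `2^r` standard monomials of the
exterior algebra to orthonormal vectors (`orthonormal_fockMap_lamBasis`) and so is unitary.

The lift is built from this model. Complex reflections generate `U(r)`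
(`closure_complexReflections`). The reflection with eigenvalue `m²` on a unit vector `u` comes from
`[u · (-m⁻¹u), m]`, which acts on spinors by `1 + (m² - 1) a*(u) a(u)`, the operator that the
reflection induces on the exterior algebra (`implements_complexReflection`). Products and inverses
give an implementer of every `g` (`exists_implements`). An implementer conjugates creation operators
by `g`, hence by unitarity annihilation operators and vectors too, so it covers `(j(g), det g)`.

Since `C_{2r} ⊗ ℂ` is the full matrix algebra (`cliffordRep_bijective`), only `±1` in `Spin(2r)`
acts trivially on vectors. Hence implementers are unique and form a homomorphism. The kernel of the
covering is central of exponent two, so two lifts agree on squares; every complex reflection is a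
square, which gives uniqueness without assuming continuity. Continuity follows by choosing a local
square root of the determinant and reading the `Spin` component off the spinor matrix. Finally,
`fockMap` is the unitary equivalence. -/

theorem block_conjTranspose (r : ℕ) (A B C D : Matrix (Fin (2 ^ r)) (Fin (2 ^ r)) ℂ) :
    (block r A B C D)ᴴ = block r Aᴴ Cᴴ Bᴴ Dᴴ := by
  simp [block, Matrix.fromBlocks_conjTranspose]

theorem block_neg (r : ℕ) (A B C D : Matrix (Fin (2 ^ r)) (Fin (2 ^ r)) ℂ) :
    -block r A B C D = block r (-A) (-B) (-C) (-D) := by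
  simp only [block, ← Matrix.fromBlocks_neg]
  rfl

theorem block_smul (r : ℕ) (a : ℂ) (A B C D : Matrix (Fin (2 ^ r)) (Fin (2 ^ r)) ℂ) :
    a • block r A B C D = block r (a • A) (a • B) (a • C) (a • D) := by
  simp only [block, ← Matrix.fromBlocks_smul]
  rfl

theorem block_mulVec (r : ℕ) (A B C D : Matrix (Fin (2 ^ r)) (Fin (2 ^ r)) ℂ)
    (x y : Fin (2 ^ r) → ℂ) :
    block r A B C D *ᵥ (Sum.elim x y ∘ (blockEquiv r).symm) =
      Sum.elim (A *ᵥ x + B *ᵥ y) (C *ᵥ x + D *ᵥ y) ∘ (blockEquiv r).symm := by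
  rw [block, Matrix.reindex_apply, Matrix.submatrix_mulVec_equiv]
  simp [Function.comp_assoc, Matrix.fromBlocks_mulVec]

/-- The Dirac matrices are skew-Hermitian. -/
theorem diracMatrix_conjTranspose (r j : ℕ) : (diracMatrix r j)ᴴ = -diracMatrix r j := by
  induction r generalizing j with
  | zero => simp [diracMatrix]
  | succ r ih =>
    rw [diracMatrix]
    split_ifs
    · simp [block_conjTranspose, block_neg, ih]
    · simp [block_conjTranspose, block_neg]
    · simp [block_conjTranspose, block_neg]

theorem diracMatrix_mul_add_mul (r : ℕ) {j k : ℕ} (hj : j < 2 * r + 1) (hk : k < 2 * r + 1) :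
    diracMatrix r j * diracMatrix r k + diracMatrix r k * diracMatrix r j =
      if j = k then (-2 : ℂ) • 1 else 0 := by
  split_ifs with h
  · subst h
    rw [diracMatrix_sq, ← two_smul ℂ, smul_neg, neg_smul]
  · rcases lt_or_gt_of_ne h with h' | h'
    · exact diracMatrix_anticomm r j k h' hk
    · rw [add_comm]; exact diracMatrix_anticomm r k j h' hj

/-- The vacuum vector: the first standard basis vector of `ℂ^(2^r)`. -/
def vacuum (r : ℕ) : Fin (2 ^ r) → ℂ := Pi.single 0 1

theorem vacuum_succ (r : ℕ) :
    vacuum (r + 1) = Sum.elim (vacuum r) 0 ∘ (blockEquiv r).symm := by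
  rw [Equiv.eq_comp_symm]
  funext i
  have h0 : blockEquiv r (Sum.inl 0) = 0 := by
    ext; simp [blockEquiv]
  rcases i with i | i
  · by_cases hi : i = 0
    · subst hi; simp [vacuum, h0]
    · have : blockEquiv r (Sum.inl i) ≠ 0 := by
        rw [← h0]; simpa using hi
      simp [vacuum, hi, this]
  · have : blockEquiv r (Sum.inr i) ≠ 0 := by
      rw [← h0]; simp
    simp [vacuum, this]

theorem star_vacuum_dotProduct_vacuum (r : ℕ) : star (vacuum r) ⬝ᵥ vacuum r = 1 := by
  simp [vacuum]

/-- The unpaired matrix of index `2r` acquires a partner at the next size; the eigenvalue `-i` is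
what makes that new pair annihilate the next vacuum. -/
theorem diracMatrix_mulVec_vacuum (r : ℕ) :
    diracMatrix r (2 * r) *ᵥ vacuum r = -Complex.I • vacuum r := by
  cases r with
  | zero => simp [diracMatrix, Matrix.neg_mulVec, Matrix.smul_mulVec]
  | succ r =>
    have h1 : ¬ 2 * (r + 1) < 2 * r + 1 := by omega
    have h2 : 2 * (r + 1) ≠ 2 * r + 1 := by omega
    rw [diracMatrix, if_neg h1, if_neg h2, vacuum_succ, block_mulVec]
    funext i
    rcases h : (blockEquiv r).symm i with j | j <;>
      simp [h, Matrix.neg_mulVec, Matrix.smul_mulVec]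

theorem diracMatrix_add_mulVec_vacuum (r : ℕ) {k : ℕ} (hk : k < r) :
    (diracMatrix r (2 * k) + Complex.I • diracMatrix r (2 * k + 1)) *ᵥ vacuum r = 0 := by
  induction r with
  | zero => omega
  | succ r ih =>
    rw [vacuum_succ]
    by_cases h : k < r
    · have h1 : 2 * k < 2 * r + 1 := by omega
      have h2 : 2 * k + 1 < 2 * r + 1 := by omega
      rw [diracMatrix, diracMatrix, if_pos h1, if_pos h2, block_smul, block_add, block_mulVec]
      simp only [smul_zero, add_zero, Matrix.zero_mulVec, Matrix.mulVec_zero, ih h]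
      funext i
      rcases (blockEquiv r).symm i with j | j <;> simp
    -- The new pair sends `(vacuum, 0)` to `(0, E vacuum + i vacuum)`, with `E` the old unpaired
    -- matrix.
    · have hk' : k = r := by omega
      subst hk'
      rw [diracMatrix, diracMatrix, if_pos (by omega), if_neg (by omega), if_pos rfl, block_smul,
        block_add, block_mulVec, Matrix.add_mulVec _ _ (vacuum k), Matrix.add_mulVec _ _ (vacuum k),
        diracMatrix_mulVec_vacuum]
      funext i
      rcases (blockEquiv k).symm i with j | j <;> simp [Matrix.smul_mulVec]

/-! ### Creation and annihilation operators -/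

/-- The creation operator of a vector of `ℂ^r`, acting on spinors. -/
def creation (r : ℕ) : EuclideanSpace ℂ (Fin r) →ₗ[ℂ] Matrix (Fin (2 ^ r)) (Fin (2 ^ r)) ℂ :=
  Fintype.linearCombination ℂ (fun k : Fin r =>
    (1 / 2 : ℂ) • (diracMatrix r (2 * k) - Complex.I • diracMatrix r (2 * k + 1))) ∘ₗ
    (WithLp.linearEquiv 2 ℂ (Fin r → ℂ)).toLinearMap

theorem creation_apply (r : ℕ) (v : EuclideanSpace ℂ (Fin r)) :
    creation r v = ∑ k : Fin r, v k •
      ((1 / 2 : ℂ) • (diracMatrix r (2 * k) - Complex.I • diracMatrix r (2 * k + 1))) := by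
  simp [creation, Fintype.linearCombination_apply]

theorem creation_conjTranspose (r : ℕ) (v : EuclideanSpace ℂ (Fin r)) :
    (creation r v)ᴴ = ∑ k : Fin r, conj (v k) •
      ((-1 / 2 : ℂ) • (diracMatrix r (2 * k) + Complex.I • diracMatrix r (2 * k + 1))) := by
  rw [creation_apply, Matrix.conjTranspose_sum]
  refine Finset.sum_congr rfl fun k _ => ?_
  simp only [Matrix.conjTranspose_smul, Matrix.conjTranspose_sub, diracMatrix_conjTranspose]
  simp only [star_div₀, star_one, star_ofNat, Complex.star_def, Complex.conj_I]
  module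

/-- Clifford multiplication by a vector is the difference of its creation and annihilation
operators. -/
theorem cliffordMap_realCoords (r : ℕ) (v : EuclideanSpace ℂ (Fin r)) :
    cliffordMap r (realCoords r v) = creation r v - (creation r v)ᴴ := by
  have key : ∀ F : ℕ → Matrix (Fin (2 ^ r)) (Fin (2 ^ r)) ℂ, ∑ j : Fin (2 * r), F j =
      ∑ k : Fin r, (F (2 * k) + F (2 * k + 1)) := by
    intro F
    have h : ∀ m : ℕ, ∑ i ∈ Finset.range (2 * m), F i =
        ∑ i ∈ Finset.range m, (F (2 * i) + F (2 * i + 1)) := by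
      intro m
      induction m with
      | zero => simp
      | succ m ih =>
        rw [show 2 * (m + 1) = 2 * m + 1 + 1 by ring, Finset.sum_range_succ, Finset.sum_range_succ,
          Finset.sum_range_succ, ih, add_assoc]
    rw [Fin.sum_univ_eq_sum_range F, Fin.sum_univ_eq_sum_range fun k => F (2 * k) + F (2 * k + 1),
      h]
  -- `key` concerns functions on `ℕ`, so the coordinates are padded by `0`; only indices below `2r`
  -- occur.
  have hF := key fun j => (if h : j < 2 * r then realCoords r v ⟨j, h⟩ else 0) • diracMatrix r j
  simp only [Fin.is_lt, dif_pos, Fin.eta] at hF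
  rw [cliffordMap, Fintype.linearCombination_apply, hF, creation_conjTranspose, creation_apply,
    ← Finset.sum_sub_distrib]
  refine Finset.sum_congr rfl fun k _ => ?_
  have h1 : 2 * (k : ℕ) < 2 * r := by omega
  have h2 : 2 * (k : ℕ) + 1 < 2 * r := by omega
  have e1 : realCoords r v ⟨2 * k, h1⟩ = (v k).re := by simp [realCoords]
  have e2 : realCoords r v ⟨2 * k + 1, h2⟩ = (v k).im := by
    have h : (2 * (k : ℕ) + 1) / 2 = k := by omega
    simp [realCoords, h, Nat.add_mod]
  rw [dif_pos h1, dif_pos h2, e1, e2]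
  -- In terms of `v k` and its conjugate, the claim is a linear identity between the two Dirac
  -- matrices.
  rw [← Complex.coe_smul (v k).re, ← Complex.coe_smul (v k).im, Complex.re_eq_add_conj,
    Complex.im_eq_sub_conj]
  have hI : (2 * Complex.I)⁻¹ = -Complex.I / 2 := by simp; ring
  simp only [div_eq_mul_inv (v k - _), hI]
  module

/-- Since `i² = -1`, the anticommutators of even and of odd indices cancel for equal signs and add
up to `-4` for opposite signs when `k = l`. The mixed ones vanish. -/
theorem diracMatrix_sub_anticomm (r : ℕ) (k l : Fin r) :
    (diracMatrix r (2 * k) - Complex.I • diracMatrix r (2 * k + 1)) *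
      (diracMatrix r (2 * l) - Complex.I • diracMatrix r (2 * l + 1)) +
    (diracMatrix r (2 * l) - Complex.I • diracMatrix r (2 * l + 1)) *
      (diracMatrix r (2 * k) - Complex.I • diracMatrix r (2 * k + 1)) = 0 ∧
    (diracMatrix r (2 * k) + Complex.I • diracMatrix r (2 * k + 1)) *
      (diracMatrix r (2 * l) - Complex.I • diracMatrix r (2 * l + 1)) +
    (diracMatrix r (2 * l) - Complex.I • diracMatrix r (2 * l + 1)) *
      (diracMatrix r (2 * k) + Complex.I • diracMatrix r (2 * k + 1)) =
        (if k = l then (-4 : ℂ) else 0) • 1 := by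
  have h1 := diracMatrix_mul_add_mul r (j := 2 * k) (k := 2 * l) (by omega) (by omega)
  have h2 := diracMatrix_mul_add_mul r (j := 2 * k) (k := 2 * l + 1) (by omega) (by omega)
  have h3 := diracMatrix_mul_add_mul r (j := 2 * k + 1) (k := 2 * l) (by omega) (by omega)
  have h4 := diracMatrix_mul_add_mul r (j := 2 * k + 1) (k := 2 * l + 1) (by omega) (by omega)
  rw [if_neg (by omega)] at h2 h3
  replace h2 := congrArg (Complex.I • ·) h2
  replace h3 := congrArg (Complex.I • ·) h3
  replace h4 := congrArg ((Complex.I * Complex.I) • ·) h4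
  simp only [smul_add, smul_zero, ← smul_smul] at h2 h3 h4
  set a := diracMatrix r (2 * k)
  set b := diracMatrix r (2 * k + 1)
  set c := diracMatrix r (2 * l)
  set d := diracMatrix r (2 * l + 1)
  have m1 : a * Complex.I • d = Complex.I • (a * d) := mul_smul_comm _ _ _
  have m2 : Complex.I • d * a = Complex.I • (d * a) := smul_mul_assoc _ _ _
  have m3 : Complex.I • b * c = Complex.I • (b * c) := smul_mul_assoc _ _ _
  have m4 : c * Complex.I • b = Complex.I • (c * b) := mul_smul_comm _ _ _
  have m5 : Complex.I • b * Complex.I • d = Complex.I • Complex.I • (b * d) := by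
    rw [smul_mul_assoc, mul_smul_comm]
  have m6 : Complex.I • d * Complex.I • b = Complex.I • Complex.I • (d * b) := by
    rw [smul_mul_assoc, mul_smul_comm]
  rw [← m1, ← m2] at h2
  rw [← m3, ← m4] at h3
  rw [← m5, ← m6] at h4
  have h14 : a * c + c * a + (Complex.I • b * Complex.I • d + Complex.I • d * Complex.I • b) = 0 := by
    rw [h1, h4]
    by_cases h : (k : ℕ) = l
    · simp only [h, if_true, smul_smul, ← add_smul, ← mul_assoc]
      rw [Complex.I_mul_I]
      norm_num
    · simp [h]
  have h14' : a * c + c * a - (Complex.I • b * Complex.I • d + Complex.I • d * Complex.I • b) =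
      (if k = l then (-4 : ℂ) else 0) • 1 := by
    rw [h1, h4]
    by_cases h : (k : ℕ) = l
    · simp only [h, Fin.ext_iff, if_true, smul_smul, ← sub_smul, ← mul_assoc]
      rw [Complex.I_mul_I]
      norm_num
    · simp [h, Fin.ext_iff]
  clear m1 m2 m3 m4 m5 m6 h4
  -- With `i b` and `i d` as opaque noncommuting symbols, only ring identities remain.
  generalize Complex.I • b = b' at *
  generalize Complex.I • d = d' at *
  constructor
  · linear_combination (norm := noncomm_ring) h14 - h2 - h3
  · linear_combination (norm := noncomm_ring) h14' + h3 - h2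

theorem creation_anticomm (r : ℕ) (v w : EuclideanSpace ℂ (Fin r)) :
    creation r v * creation r w + creation r w * creation r v = 0 := by
  simp only [creation_apply, Finset.sum_mul, Finset.mul_sum]
  rw [Finset.sum_comm, ← Finset.sum_add_distrib]
  refine Finset.sum_eq_zero fun k _ => ?_
  rw [← Finset.sum_add_distrib]
  refine Finset.sum_eq_zero fun l _ => ?_
  simp only [smul_mul_assoc, mul_smul_comm]
  have h := (diracMatrix_sub_anticomm r k l).1
  linear_combination (norm := module) (v k * w l / 4) • h

theorem creation_mul_self (r : ℕ) (v : EuclideanSpace ℂ (Fin r)) :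
    creation r v * creation r v = 0 := by
  have h := creation_anticomm r v v
  rw [← two_smul ℂ] at h
  exact (smul_eq_zero.mp h).resolve_left two_ne_zero

theorem annihilation_mul_creation (r : ℕ) (v w : EuclideanSpace ℂ (Fin r)) :
    (creation r v)ᴴ * creation r w + creation r w * (creation r v)ᴴ = inner ℂ v w • 1 := by
  have hin : inner ℂ v w = ∑ k : Fin r, ∑ l : Fin r, if k = l then conj (v k) * w l else 0 := by
    simp [PiLp.inner_apply, mul_comm]
  rw [creation_conjTranspose]
  simp only [creation_apply, Finset.sum_mul, Finset.mul_sum]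
  rw [hin, Finset.sum_comm, ← Finset.sum_add_distrib, Finset.sum_smul]
  refine Finset.sum_congr rfl fun k _ => ?_
  rw [← Finset.sum_add_distrib, Finset.sum_smul]
  refine Finset.sum_congr rfl fun l _ => ?_
  simp only [smul_mul_assoc, mul_smul_comm]
  have h := (diracMatrix_sub_anticomm r k l).2
  have h' : (if k = l then conj (v k) * w l else 0) =
      (-(conj (v k) * w l) / 4) * (if k = l then (-4 : ℂ) else 0) := by
    split_ifs <;> ring
  rw [h', mul_smul]
  linear_combination (norm := module) (-(conj (v k) * w l) / 4) • h

theorem annihilation_mulVec_vacuum (r : ℕ) (v : EuclideanSpace ℂ (Fin r)) :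
    (creation r v)ᴴ *ᵥ vacuum r = 0 := by
  rw [creation_conjTranspose, Matrix.sum_mulVec]
  refine Finset.sum_eq_zero fun k _ => ?_
  rw [Matrix.smul_mulVec, Matrix.smul_mulVec, diracMatrix_add_mulVec_vacuum r k.2, smul_zero,
    smul_zero]

/-! ### The Fock space isomorphism -/

/-- The action of `Λ^• ℂ^r` on spinors by creation operators. -/
def fockHom (r : ℕ) : Lam r →ₐ[ℂ] Matrix (Fin (2 ^ r)) (Fin (2 ^ r)) ℂ :=
  ExteriorAlgebra.lift ℂ ⟨creation r, creation_mul_self r⟩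

@[simp]
theorem fockHom_ι (r : ℕ) (v : EuclideanSpace ℂ (Fin r)) :
    fockHom r (ExteriorAlgebra.ι ℂ v) = creation r v :=
  ExteriorAlgebra.lift_ι_apply ℂ _ _ _

/-- Lists allow induction on the number of creation operators. The increasing order matters only for
the monomial itself, not for the inner products computed later. -/
theorem exists_list_lamBasis (r : ℕ) (s : Finset (Fin r)) :
    ∃ l : List (Fin r), l.Nodup ∧ (∀ k, k ∈ l ↔ k ∈ s) ∧
      lamBasis r s =
        (l.map fun k => ExteriorAlgebra.ι ℂ (EuclideanSpace.single k (1 : ℂ))).prod := by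
  refine ⟨List.ofFn (s.orderEmbOfFin rfl), ?_, ?_, ?_⟩
  · exact List.nodup_ofFn.mpr (s.orderEmbOfFin rfl).injective
  · intro k
    rw [List.mem_ofFn, ← Set.mem_range, Finset.range_orderEmbOfFin, Finset.mem_coe]
  · rw [lamBasis, ExteriorAlgebra.basis_apply_ofCard _ (rfl : s.card = s.card),
      ExteriorAlgebra.ιMulti_family, ExteriorAlgebra.ιMulti_apply, List.map_ofFn]
    congr 1
    refine congrArg List.ofFn ?_
    funext i
    simp [Set.powersetCard.ofFinEmbEquiv_symm_apply]

/-- The spinor obtained from the vacuum by creating the basis vectors of a list. -/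
def fockState (r : ℕ) (l : List (Fin r)) : Fin (2 ^ r) → ℂ :=
  (l.map fun k => creation r (EuclideanSpace.single k 1)).prod *ᵥ vacuum r

theorem fockState_cons (r : ℕ) (k : Fin r) (l : List (Fin r)) :
    fockState r (k :: l) = creation r (EuclideanSpace.single k 1) *ᵥ fockState r l := by
  simp [fockState, Matrix.mulVec_mulVec]

theorem annihilation_mulVec_creation_mulVec (r : ℕ) (v w : EuclideanSpace ℂ (Fin r))
    (x : Fin (2 ^ r) → ℂ) :
    (creation r v)ᴴ *ᵥ creation r w *ᵥ x =
      inner ℂ v w • x - creation r w *ᵥ (creation r v)ᴴ *ᵥ x := by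
  rw [Matrix.mulVec_mulVec, Matrix.mulVec_mulVec, eq_sub_iff_add_eq, ← Matrix.add_mulVec,
    annihilation_mul_creation, Matrix.smul_mulVec, Matrix.one_mulVec]

/-- The annihilator anticommutes past creators of other basis vectors until it reaches the vacuum.
-/
theorem annihilation_mulVec_fockState (r : ℕ) {k : Fin r} {l : List (Fin r)} (h : k ∉ l) :
    (creation r (EuclideanSpace.single k 1))ᴴ *ᵥ fockState r l = 0 := by
  induction l with
  | nil => simp [fockState, annihilation_mulVec_vacuum]
  | cons j l ih =>
    rw [List.mem_cons, not_or] at h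
    rw [fockState_cons, annihilation_mulVec_creation_mulVec, ih h.2]
    simp [EuclideanSpace.inner_single_left, h.1]

/-- Move the creator to the occurrence of `k`, where its square is zero (Pauli exclusion). -/
theorem creation_mulVec_fockState (r : ℕ) {k : Fin r} {l : List (Fin r)} (h : k ∈ l) :
    creation r (EuclideanSpace.single k 1) *ᵥ fockState r l = 0 := by
  induction l with
  | nil => simp at h
  | cons j l ih =>
    rw [fockState_cons]
    by_cases hj : k = j
    · rw [hj, Matrix.mulVec_mulVec, creation_mul_self, Matrix.zero_mulVec]
    · rw [Matrix.mulVec_mulVec, eq_neg_of_add_eq_zero_left (creation_anticomm r _ _),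
        Matrix.neg_mulVec, ← Matrix.mulVec_mulVec,
        ih ((List.mem_cons.mp h).resolve_left hj), Matrix.mulVec_zero, neg_zero]

theorem star_mulVec_dotProduct {n : Type*} [Fintype n] (A : Matrix n n ℂ) (x y : n → ℂ) :
    star (A *ᵥ x) ⬝ᵥ y = star x ⬝ᵥ (Aᴴ *ᵥ y) := by
  rw [Matrix.star_mulVec, Matrix.dotProduct_mulVec]

theorem star_fockState_dotProduct_self (r : ℕ) {l : List (Fin r)} (h : l.Nodup) :
    star (fockState r l) ⬝ᵥ fockState r l = 1 := by
  induction l with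
  | nil => simp [fockState, star_vacuum_dotProduct_vacuum]
  | cons j l ih =>
    rw [List.nodup_cons] at h
    rw [fockState_cons, star_mulVec_dotProduct, annihilation_mulVec_creation_mulVec,
      annihilation_mulVec_fockState r h.1]
    simpa using ih h.2

/-- The number operator of `k` fixes the first state; moving its factors across the inner product
lets the annihilator kill the second. -/
theorem star_fockState_dotProduct_of_mem (r : ℕ) {k : Fin r} {l l' : List (Fin r)} (h : k ∈ l)
    (h' : k ∉ l') : star (fockState r l) ⬝ᵥ fockState r l' = 0 := by
  have e := annihilation_mulVec_creation_mulVec r (EuclideanSpace.single k 1)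
    (EuclideanSpace.single k 1) (fockState r l)
  rw [creation_mulVec_fockState r h] at e
  have e' : fockState r l = creation r (EuclideanSpace.single k 1) *ᵥ
      (creation r (EuclideanSpace.single k 1))ᴴ *ᵥ fockState r l := by
    simpa [sub_eq_zero, eq_comm] using e
  rw [e', star_mulVec_dotProduct, annihilation_mulVec_fockState r h', dotProduct_zero]

/-- The spinor of an element of the exterior algebra. -/
def fockMap (r : ℕ) : Lam r →ₗ[ℂ] EuclideanSpace ℂ (Fin (2 ^ r)) where
  toFun x := WithLp.toLp 2 (fockHom r x *ᵥ vacuum r)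
  map_add' x y := by simp [Matrix.add_mulVec]
  map_smul' a x := by simp [Matrix.smul_mulVec]

theorem fockMap_apply (r : ℕ) (x : Lam r) :
    fockMap r x = WithLp.toLp 2 (fockHom r x *ᵥ vacuum r) := rfl

theorem fockMap_mul (r : ℕ) (x y : Lam r) :
    fockMap r (x * y) = Matrix.toLpLin 2 2 (fockHom r x) (fockMap r y) := by
  simp [fockMap_apply, Matrix.toLpLin_toLp, Matrix.mulVec_mulVec]

theorem exists_list_fockMap_lamBasis (r : ℕ) (s : Finset (Fin r)) :
    ∃ l : List (Fin r), l.Nodup ∧ (∀ k, k ∈ l ↔ k ∈ s) ∧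
      fockMap r (lamBasis r s) = WithLp.toLp 2 (fockState r l) := by
  obtain ⟨l, h1, h2, h3⟩ := exists_list_lamBasis r s
  refine ⟨l, h1, h2, ?_⟩
  rw [fockMap_apply, h3, map_list_prod, List.map_map, fockState]
  simp [Function.comp_def]

theorem orthonormal_fockMap_lamBasis (r : ℕ) :
    Orthonormal ℂ fun s => fockMap r (lamBasis r s) := by
  rw [orthonormal_iff_ite]
  intro s t
  obtain ⟨l, h1, h2, h3⟩ := exists_list_fockMap_lamBasis r s
  obtain ⟨l', h1', h2', h3'⟩ := exists_list_fockMap_lamBasis r t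
  split_ifs with hst
  · subst hst
    rw [h3, EuclideanSpace.inner_toLp_toLp, dotProduct_comm, star_fockState_dotProduct_self r h1]
  · rw [h3, h3', EuclideanSpace.inner_toLp_toLp, dotProduct_comm]
    -- Distinct sets differ by an element of one of them; when it lies in `t`, the previous lemma
    -- applies after conjugation.
    by_cases hs : s ⊆ t
    · obtain ⟨k, hk, hk'⟩ := Finset.not_subset.mp fun h => hst (subset_antisymm hs h)
      rw [← star_star (fockState r l'), star_dotProduct_star,
        star_fockState_dotProduct_of_mem r ((h2' k).mpr hk) (mt (h2 k).mp hk'), star_zero]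
    · obtain ⟨k, hk, hk'⟩ := Finset.not_subset.mp hs
      exact star_fockState_dotProduct_of_mem r ((h2 k).mpr hk) (mt (h2' k).mp hk')

theorem orthonormal_lamBasis (r : ℕ) : Orthonormal ℂ (lamBasis r) := by
  rw [orthonormal_iff_ite]
  intro s t
  change ∑ u, conj ((lamBasis r).repr (lamBasis r s) u) * (lamBasis r).repr (lamBasis r t) u = _
  simp [Finsupp.single_apply]

/-- The spinors of the standard basis of the exterior algebra form an orthonormal basis. -/
def fockBasis (r : ℕ) : OrthonormalBasis (Finset (Fin r)) ℂ (EuclideanSpace ℂ (Fin (2 ^ r))) :=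
  (basisOfOrthonormalOfCardEqFinrank (orthonormal_fockMap_lamBasis r) (by simp)).toOrthonormalBasis
    (by simpa using orthonormal_fockMap_lamBasis r)

@[simp]
theorem fockBasis_apply (r : ℕ) (s : Finset (Fin r)) :
    fockBasis r s = fockMap r (lamBasis r s) := by
  simp [fockBasis]

/-- The unitary isomorphism between the exterior algebra and the space of spinors. -/
def fockEquiv (r : ℕ) : Lam r ≃ₗᵢ[ℂ] EuclideanSpace ℂ (Fin (2 ^ r)) :=
  ((lamBasis r).toOrthonormalBasis (orthonormal_lamBasis r)).equiv (fockBasis r) (Equiv.refl _)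

theorem fockEquiv_apply (r : ℕ) (x : Lam r) : fockEquiv r x = fockMap r x := by
  have h : (fockEquiv r).toLinearEquiv.toLinearMap = fockMap r := by
    refine (lamBasis r).ext fun s => ?_
    have := OrthonormalBasis.equiv_apply_basis
      ((lamBasis r).toOrthonormalBasis (orthonormal_lamBasis r)) (fockBasis r) (Equiv.refl _) s
    simpa [fockEquiv] using this
  exact LinearMap.congr_fun h x

theorem fockMap_surjective (r : ℕ) : Function.Surjective (fockMap r) := fun y =>
  ⟨(fockEquiv r).symm y, by rw [← fockEquiv_apply, LinearIsometryEquiv.apply_symm_apply]⟩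

/-! ### The Clifford algebra is a full matrix algebra -/

theorem cliffordRep_tmul (r : ℕ) (z : ℂ) (x : Cliff (2 * r)) :
    cliffordRep r (z ⊗ₜ x) = z • cliffordRep r (1 ⊗ₜ x) := by
  rw [← map_smul, TensorProduct.smul_tmul', smul_eq_mul, mul_one]

theorem cliffordRep_ι (r : ℕ) (v : Fin (2 * r) → ℝ) :
    cliffordRep r (1 ⊗ₜ CliffordAlgebra.ι (negForm (2 * r)) v) = cliffordMap r v := by
  refine (Algebra.TensorProduct.lift_tmul (Algebra.ofId ℂ _) (CliffordAlgebra.lift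
    (negForm (2 * r)) ⟨cliffordMap r, cliffordMap_sq r⟩) _ _ _).trans ?_
  rw [map_one, one_mul, CliffordAlgebra.lift_ι_apply]

theorem diracMatrix_mem_range (r : ℕ) {j : ℕ} (hj : j < 2 * r) :
    diracMatrix r j ∈ (cliffordRep r).range := by
  refine ⟨1 ⊗ₜ CliffordAlgebra.ι (negForm (2 * r)) (Pi.single ⟨j, hj⟩ 1), ?_⟩
  change cliffordRep r _ = _
  rw [cliffordRep_ι, cliffordMap, Fintype.linearCombination_apply_single, one_smul]

theorem creation_mem_range (r : ℕ) (v : EuclideanSpace ℂ (Fin r)) :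
    creation r v ∈ (cliffordRep r).range := by
  rw [creation_apply]
  refine Subalgebra.sum_mem _ fun k _ => Subalgebra.smul_mem _ (Subalgebra.smul_mem _
    (Subalgebra.sub_mem _ ?_ (Subalgebra.smul_mem _ ?_ _)) _) _
  all_goals exact diracMatrix_mem_range r (by omega)

theorem annihilation_mem_range (r : ℕ) (v : EuclideanSpace ℂ (Fin r)) :
    (creation r v)ᴴ ∈ (cliffordRep r).range := by
  rw [creation_conjTranspose]
  refine Subalgebra.sum_mem _ fun k _ => Subalgebra.smul_mem _ (Subalgebra.smul_mem _
    (Subalgebra.add_mem _ ?_ (Subalgebra.smul_mem _ ?_ _)) _) _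
  all_goals exact diracMatrix_mem_range r (by omega)

/-- The adjoint is carried through the induction because the range is not yet known to be closed
under adjoints. -/
theorem fockHom_mem_range (r : ℕ) (x : Lam r) :
    fockHom r x ∈ (cliffordRep r).range ∧ (fockHom r x)ᴴ ∈ (cliffordRep r).range := by
  induction x using ExteriorAlgebra.induction with
  | algebraMap z =>
    rw [AlgHom.commutes, Algebra.algebraMap_eq_smul_one, Matrix.conjTranspose_smul,
      Matrix.conjTranspose_one]
    exact ⟨Subalgebra.smul_mem _ (one_mem _) _, Subalgebra.smul_mem _ (one_mem _) _⟩
  | ι v => simpa only [fockHom_ι] using ⟨creation_mem_range r v, annihilation_mem_range r v⟩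
  | mul x y hx hy =>
    rw [map_mul, Matrix.conjTranspose_mul]
    exact ⟨mul_mem hx.1 hy.1, mul_mem hy.2 hx.2⟩
  | add x y hx hy =>
    rw [map_add, Matrix.conjTranspose_add]
    exact ⟨add_mem hx.1 hy.1, add_mem hx.2 hy.2⟩

/-- Each factor is one minus a number operator: it keeps states in which `k` is empty and kills
those in which it is occupied. -/
theorem annihilation_mul_creation_prod_mulVec_fockState (r : ℕ) (m l : List (Fin r)) :
    (m.map fun k => (creation r (EuclideanSpace.single k 1))ᴴ *
        creation r (EuclideanSpace.single k 1)).prod *ᵥ fockState r l =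
      if ∃ k ∈ m, k ∈ l then 0 else fockState r l := by
  induction m with
  | nil => simp
  | cons j m ih =>
    rw [List.map_cons, List.prod_cons, ← Matrix.mulVec_mulVec, ih]
    by_cases h : ∃ k ∈ m, k ∈ l
    · have h' : ∃ k ∈ j :: m, k ∈ l := by
        obtain ⟨k, hk, hl⟩ := h
        exact ⟨k, List.mem_cons_of_mem _ hk, hl⟩
      rw [if_pos h, if_pos h', Matrix.mulVec_zero]
    · rw [if_neg h, ← Matrix.mulVec_mulVec]
      by_cases hj : j ∈ l
      · rw [creation_mulVec_fockState r hj, Matrix.mulVec_zero,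
          if_pos ⟨j, List.mem_cons_self, hj⟩]
      · rw [annihilation_mulVec_creation_mulVec, annihilation_mulVec_fockState r hj, if_neg]
        · simp
        · rintro ⟨k, hk, hl⟩
          rcases List.mem_cons.mp hk with rfl | hk
          · exact hj hl
          · exact h ⟨k, hk, hl⟩

/-- The projection onto the vacuum is a product of creation and annihilation operators. -/
theorem annihilation_mul_creation_prod_finRange (r : ℕ) :
    ((List.finRange r).map fun k => (creation r (EuclideanSpace.single k 1))ᴴ *
        creation r (EuclideanSpace.single k 1)).prod = vecMulVec (vacuum r) (star (vacuum r)) := by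
  apply (Matrix.toLpLin 2 2).injective
  refine (fockBasis r).toBasis.ext fun s => ?_
  obtain ⟨l, h1, h2, h3⟩ := exists_list_fockMap_lamBasis r s
  have h0 : fockState r [] = vacuum r := by simp [fockState]
  rw [OrthonormalBasis.coe_toBasis, fockBasis_apply, h3, Matrix.toLpLin_toLp,
    Matrix.toLpLin_toLp]
  congr 1
  rw [Matrix.toLin'_apply, Matrix.toLin'_apply,
    annihilation_mul_creation_prod_mulVec_fockState, Matrix.vecMulVec_mulVec]
  -- Only the empty list survives the product over all `k`, and every other state is orthogonal to
  -- the vacuum.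
  rcases l with _ | ⟨k, l⟩
  · simp [h0, star_vacuum_dotProduct_vacuum]
  · have h := star_fockState_dotProduct_of_mem r (k := k) (l := k :: l) (l' := [])
      List.mem_cons_self (by simp)
    rw [h0] at h
    rw [if_pos ⟨k, List.mem_finRange k, List.mem_cons_self⟩, ← star_star (fockState r (k :: l)),
      star_dotProduct_star, h]
    simp

/-- Every spinor is the vacuum hit by an element of `fockHom`, so a rank one operator is the vacuum
projection between two such elements, the right one adjoint. -/
theorem vecMulVec_mem_range (r : ℕ) (x y : Fin (2 ^ r) → ℂ) :
    vecMulVec x (star y) ∈ (cliffordRep r).range := by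
  obtain ⟨a, ha⟩ := fockMap_surjective r (WithLp.toLp 2 x)
  obtain ⟨b, hb⟩ := fockMap_surjective r (WithLp.toLp 2 y)
  replace ha : fockHom r a *ᵥ vacuum r = x := congrArg WithLp.ofLp ha
  replace hb : fockHom r b *ᵥ vacuum r = y := congrArg WithLp.ofLp hb
  have h : vecMulVec x (star y) =
      fockHom r a * vecMulVec (vacuum r) (star (vacuum r)) * (fockHom r b)ᴴ := by
    rw [Matrix.mul_vecMulVec, Matrix.vecMulVec_mul, ha, ← Matrix.star_mulVec, hb]
  rw [h, ← annihilation_mul_creation_prod_finRange]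
  refine mul_mem (mul_mem (fockHom_mem_range r a).1 (list_prod_mem ?_)) (fockHom_mem_range r b).2
  intro M hM
  obtain ⟨k, -, rfl⟩ := List.mem_map.mp hM
  exact mul_mem (annihilation_mem_range r _) (creation_mem_range r _)

theorem cliffordRep_surjective (r : ℕ) : Function.Surjective (cliffordRep r) := by
  intro M
  change M ∈ (cliffordRep r).range
  rw [Matrix.matrix_eq_sum_single M]
  refine Subalgebra.sum_mem _ fun i _ => Subalgebra.sum_mem _ fun j _ => ?_
  have h : Matrix.single i j (M i j) =
      M i j • vecMulVec (Pi.single i 1) (star (Pi.single j (1 : ℂ))) := by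
    rw [← Pi.single_star, star_one]
    ext a b
    simp [Matrix.single_apply, vecMulVec_apply, Pi.single_apply]
    grind
  rw [h]
  exact Subalgebra.smul_mem _ (vecMulVec_mem_range r _ _) _

/-- The standard basis of the Clifford algebra, transported from the exterior algebra. -/
def cliffBasis (n : ℕ) : Module.Basis (Finset (Fin n)) ℝ (Cliff n) :=
  (Pi.basisFun ℝ (Fin n)).ExteriorAlgebra.map (CliffordAlgebra.equivExterior (negForm n)).symm

instance cliff_finite (n : ℕ) : Module.Finite ℝ (Cliff n) := Module.Finite.of_basis (cliffBasis n)

theorem finrank_cliff (n : ℕ) : Module.finrank ℝ (Cliff n) = 2 ^ n := by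
  rw [Module.finrank_eq_card_basis (cliffBasis n)]
  simp

/-- Both sides have complex dimension `2^(2r) = (2^r)²`, so surjectivity suffices. -/
theorem cliffordRep_bijective (r : ℕ) : Function.Bijective (cliffordRep r) := by
  refine ⟨?_, cliffordRep_surjective r⟩
  refine (LinearMap.injective_iff_surjective_of_finrank_eq_finrank
    (f := (cliffordRep r).toLinearMap) ?_).mpr (cliffordRep_surjective r)
  rw [Module.finrank_baseChange, finrank_cliff, Module.finrank_matrix]
  simp
  ring

/-- The isomorphism `C_{2r} ⊗ ℂ ≃ M_{2^r}(ℂ)`. -/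
def cliffordEquiv (r : ℕ) :
    (ℂ ⊗[ℝ] Cliff (2 * r)) ≃ₐ[ℂ] Matrix (Fin (2 ^ r)) (Fin (2 ^ r)) ℂ :=
  AlgEquiv.ofBijective (cliffordRep r) (cliffordRep_bijective r)

/-- The real part of a matrix, regarded as an element of `C_{2r} ⊗ ℂ`. -/
def cliffPart (r : ℕ) : Matrix (Fin (2 ^ r)) (Fin (2 ^ r)) ℂ →ₗ[ℝ] Cliff (2 * r) :=
  (TensorProduct.lid ℝ (Cliff (2 * r))).toLinearMap ∘ₗ
    LinearMap.rTensor (Cliff (2 * r)) Complex.reLm ∘ₗ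
    (cliffordEquiv r).symm.toLinearMap.restrictScalars ℝ

theorem cliffPart_cliffordRep (r : ℕ) (z : ℂ) (x : Cliff (2 * r)) :
    cliffPart r (cliffordRep r (z ⊗ₜ x)) = z.re • x := by
  have h : (cliffordEquiv r).symm (cliffordRep r (z ⊗ₜ x)) = z ⊗ₜ x :=
    (cliffordEquiv r).symm_apply_apply (z ⊗ₜ x)
  simp [cliffPart, h]

theorem continuous_cliffPart (r : ℕ) : Continuous (cliffPart r) := by
  have : IsModuleTopology ℝ (Cliff (2 * r)) := ⟨rfl⟩
  have := IsModuleTopology.toContinuousAdd ℝ (Cliff (2 * r))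
  have := IsModuleTopology.topologicalAddGroup ℝ (Cliff (2 * r))
  have : ContinuousSMul ℝ (Cliff (2 * r)) := ModuleTopology.continuousSMul ℝ (Cliff (2 * r))
  exact LinearMap.continuous_of_finiteDimensional _

theorem cliffordRep_one_tmul_injective (r : ℕ) :
    Function.Injective fun x : Cliff (2 * r) => cliffordRep r (1 ⊗ₜ x) := fun x y h => by
  simpa [cliffPart_cliffordRep] using congrArg (cliffPart r) h

theorem cliffordMap_injective (r : ℕ) : Function.Injective (cliffordMap r) := fun v w h => by
  rw [← cliffordRep_ι, ← cliffordRep_ι] at h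
  rw [← vecPart_ι (2 * r) v, cliffordRep_one_tmul_injective r h, vecPart_ι]

/-- An element of `Spin(2r)` that commutes with all vectors is `± 1`. -/
theorem spin_eq_one_or_neg_one (r : ℕ) (g : Spin (2 * r))
    (h : ∀ v, (g : Cliff (2 * r)) * CliffordAlgebra.ι (negForm (2 * r)) v =
      CliffordAlgebra.ι (negForm (2 * r)) v * g) :
    (g : Cliff (2 * r)) = 1 ∨ (g : Cliff (2 * r)) = -1 := by
  have h1 : ∀ x : Cliff (2 * r), Commute (g : Cliff (2 * r)) x := by
    intro x
    induction x using CliffordAlgebra.induction with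
    | algebraMap a => exact (Algebra.commutes a _).symm
    | ι v => exact h v
    | mul x y hx hy => exact hx.mul_right hy
    | add x y hx hy => exact hx.add_right hy
  have h2 : ∀ t : ℂ ⊗[ℝ] Cliff (2 * r), Commute ((1 : ℂ) ⊗ₜ[ℝ] (g : Cliff (2 * r))) t := by
    intro t
    induction t using TensorProduct.induction_on with
    | zero => exact Commute.zero_right _
    | tmul z x => simp [Commute, SemiconjBy, (h1 x).eq]
    | add x y hx hy => exact hx.add_right hy
  have h3 : ∀ M, Commute (cliffordRep r ((1 : ℂ) ⊗ₜ[ℝ] (g : Cliff (2 * r)))) M := by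
    intro M
    obtain ⟨t, rfl⟩ := cliffordRep_surjective r M
    exact (h2 t).map _
  -- The action of `g` is central in the full matrix algebra, hence a scalar; taking the `Cliff`
  -- part makes `g` a real scalar, and `star g * g = 1` leaves `±1`.
  obtain ⟨z, hz⟩ := Matrix.mem_range_scalar_of_commute_single fun i j _ => (h3 (single i j 1)).symm
  have h4 : cliffordRep r (z ⊗ₜ 1) = cliffordRep r ((1 : ℂ) ⊗ₜ[ℝ] (g : Cliff (2 * r))) := by
    rw [← hz, cliffordRep_tmul, ← Algebra.TensorProduct.one_def, map_one,
      Matrix.scalar_apply, Matrix.smul_one_eq_diagonal]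
  have h5 : z.re • (1 : Cliff (2 * r)) = g := by
    simpa [cliffPart_cliffordRep] using congrArg (cliffPart r) h4
  have h6 := spinGroup.coe_star_mul_self g
  rw [← h5, CliffordAlgebra.star_smul, star_one, smul_mul_smul_comm, mul_one,
    ← Algebra.algebraMap_eq_smul_one] at h6
  have h7 : z.re * z.re = 1 := by
    apply (algebraMap ℝ (Cliff (2 * r))).injective
    rw [h6, map_one]
  rw [← h5]
  rcases mul_self_eq_one_iff.mp h7 with h | h
  · left; rw [h, one_smul]
  · right; rw [h, neg_smul, one_smul]

/-! ### Complex reflections generate the unitary group -/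

theorem star_dotProduct_eq_inner {r : ℕ} (u v : EuclideanSpace ℂ (Fin r)) :
    star (u : Fin r → ℂ) ⬝ᵥ v = inner ℂ u v := by
  rw [dotProduct_comm]; rfl

theorem vecMulVec_mul_self_of_norm_eq_one {r : ℕ} {u : EuclideanSpace ℂ (Fin r)} (hu : ‖u‖ = 1) :
    vecMulVec (u : Fin r → ℂ) (star (u : Fin r → ℂ)) * vecMulVec u (star (u : Fin r → ℂ)) =
      vecMulVec u (star (u : Fin r → ℂ)) := by
  rw [Matrix.vecMulVec_mul_vecMulVec, star_dotProduct_eq_inner, inner_self_eq_norm_sq_to_K, hu]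
  simp

theorem one_add_vecMulVec_mul {r : ℕ} {u : EuclideanSpace ℂ (Fin r)} (hu : ‖u‖ = 1) (z w : ℂ) :
    (1 + (z - 1) • vecMulVec (u : Fin r → ℂ) (star (u : Fin r → ℂ))) *
      (1 + (w - 1) • vecMulVec (u : Fin r → ℂ) (star (u : Fin r → ℂ))) =
      1 + (z * w - 1) • vecMulVec (u : Fin r → ℂ) (star (u : Fin r → ℂ)) := by
  have h := vecMulVec_mul_self_of_norm_eq_one hu
  rw [mul_add, add_mul, add_mul, smul_mul_smul_comm, h]
  simp only [one_mul, mul_one]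
  module

/-- The unitary map that multiplies the unit vector `u` by `z` and fixes its orthogonal
complement. -/
def complexReflection {r : ℕ} (u : EuclideanSpace ℂ (Fin r)) (hu : ‖u‖ = 1) (z : Circle) : U r :=
  ⟨1 + ((z : ℂ) - 1) • vecMulVec (u : Fin r → ℂ) (star (u : Fin r → ℂ)), by
    have h : star (1 + ((z : ℂ) - 1) • vecMulVec (u : Fin r → ℂ) (star (u : Fin r → ℂ))) =
        1 + (((z⁻¹ : Circle) : ℂ) - 1) • vecMulVec (u : Fin r → ℂ) (star (u : Fin r → ℂ)) := by
      rw [Circle.coe_inv_eq_conj, star_eq_conjTranspose, Matrix.conjTranspose_add,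
        Matrix.conjTranspose_smul, Matrix.conjTranspose_one, Matrix.conjTranspose_vecMulVec]
      simp
    rw [Matrix.mem_unitaryGroup_iff, h, one_add_vecMulVec_mul hu]
    simp⟩

theorem complexReflection_mul {r : ℕ} (u : EuclideanSpace ℂ (Fin r)) (hu : ‖u‖ = 1)
    (z w : Circle) :
    complexReflection u hu z * complexReflection u hu w = complexReflection u hu (z * w) :=
  Subtype.ext (one_add_vecMulVec_mul hu z w)

theorem toLpLin_complexReflection {r : ℕ} (u : EuclideanSpace ℂ (Fin r)) (hu : ‖u‖ = 1)
    (z : Circle) (v : EuclideanSpace ℂ (Fin r)) :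
    Matrix.toLpLin 2 2 (complexReflection u hu z : Matrix (Fin r) (Fin r) ℂ) v =
      v + (((z : ℂ) - 1) * inner ℂ u v) • u := by
  rw [Matrix.toLpLin_apply, complexReflection, Matrix.add_mulVec, Matrix.one_mulVec,
    Matrix.smul_mulVec, Matrix.vecMulVec_mulVec, star_dotProduct_eq_inner]
  ext i
  simp
  ring

theorem detCircle_complexReflection {r : ℕ} (u : EuclideanSpace ℂ (Fin r)) (hu : ‖u‖ = 1)
    (z : Circle) : detCircle r (complexReflection u hu z) = z := by
  refine Circle.ext ?_
  change (1 + ((z : ℂ) - 1) • vecMulVec (u : Fin r → ℂ) (star (u : Fin r → ℂ))).det = z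
  rw [← Matrix.smul_vecMulVec, Matrix.vecMulVec_eq Unit,
    Matrix.det_one_add_replicateCol_mul_replicateRow, dotProduct_smul, star_dotProduct_eq_inner,
    inner_self_eq_norm_sq_to_K, hu]
  simp

/-- Take `u` along `e - w` and solve `(z - 1)⟨u, w⟩ u = e - w` for `z`. Vectors orthogonal to both
`e` and `w` are orthogonal to `u`, hence fixed. -/
theorem exists_complexReflection {r : ℕ} (e w : EuclideanSpace ℂ (Fin r)) (he : ‖e‖ = 1)
    (hw : ‖w‖ = 1) : ∃ (u : EuclideanSpace ℂ (Fin r)) (hu : ‖u‖ = 1) (z : Circle),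
      Matrix.toLpLin 2 2 (complexReflection u hu z : Matrix (Fin r) (Fin r) ℂ) w = e ∧
      ∀ v, inner ℂ e v = 0 → inner ℂ w v = 0 →
        Matrix.toLpLin 2 2 (complexReflection u hu z : Matrix (Fin r) (Fin r) ℂ) v = v := by
  simp only [toLpLin_complexReflection]
  by_cases h : e = w
  · exact ⟨e, he, 1, by simp [h], by simp⟩
  have hd : ‖e - w‖ ≠ 0 := norm_ne_zero_iff.mpr (sub_ne_zero.mpr h)
  have hee : inner ℂ e e = (1 : ℂ) := by rw [inner_self_eq_norm_sq_to_K, he]; simp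
  have hww : inner ℂ w w = (1 : ℂ) := by rw [inner_self_eq_norm_sq_to_K, hw]; simp
  have hnorm : ((‖e - w‖ : ℝ) : ℂ) ^ 2 = 2 - inner ℂ e w - conj (inner ℂ e w) := by
    have h1 : inner ℂ (e - w) (e - w) = ((‖e - w‖ : ℝ) : ℂ) ^ 2 := inner_self_eq_norm_sq_to_K _
    rw [← h1, inner_sub_left, inner_sub_right, inner_sub_right, hee, hww, inner_conj_symm]
    ring
  have hd' : ((‖e - w‖ : ℝ) : ℂ) ≠ 0 := Complex.ofReal_ne_zero.mpr hd
  have ha : inner ℂ e w - 1 ≠ (0 : ℂ) := by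
    intro h0
    rw [sub_eq_zero.mp h0] at hnorm
    apply hd'
    rw [← sq_eq_zero_iff, hnorm]
    simp
    norm_num
  -- The numerator is minus the conjugate of the denominator, so the quotient has modulus one.
  have hz : (1 - conj (inner ℂ e w)) / (inner ℂ e w - 1) ∈ Submonoid.unitSphere ℂ := by
    have : ‖1 - conj (inner ℂ e w)‖ = ‖(inner ℂ e w - 1 : ℂ)‖ := by
      rw [← Complex.norm_conj, map_sub, map_one, Complex.conj_conj, norm_sub_rev]
    have h1 : ‖(1 - conj (inner ℂ e w)) / (inner ℂ e w - 1 : ℂ)‖ = 1 := by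
      rw [norm_div, this, div_self (norm_ne_zero_iff.mpr ha)]
    simpa [Submonoid.unitSphere] using h1
  refine ⟨((‖e - w‖ : ℝ) : ℂ)⁻¹ • (e - w), ?_, ⟨_, hz⟩, ?_, ?_⟩
  · rw [norm_smul, norm_inv, Complex.norm_real, norm_norm, inv_mul_cancel₀ hd]
  · have h1 : inner ℂ (((‖e - w‖ : ℝ) : ℂ)⁻¹ • (e - w)) w =
        ((‖e - w‖ : ℝ) : ℂ)⁻¹ * (inner ℂ e w - 1) := by
      rw [inner_smul_left, inner_sub_left, hww]
      simp
    rw [h1, smul_smul]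
    have h2 : ((1 - conj (inner ℂ e w)) / (inner ℂ e w - 1) - 1) *
        (((‖e - w‖ : ℝ) : ℂ)⁻¹ * (inner ℂ e w - 1)) * ((‖e - w‖ : ℝ) : ℂ)⁻¹ = 1 := by
      have h3 : (1 - conj (inner ℂ e w)) / (inner ℂ e w - 1) - 1 =
          ((‖e - w‖ : ℝ) : ℂ) ^ 2 / (inner ℂ e w - 1) := by
        rw [hnorm]; field_simp; ring
      rw [h3]
      field_simp
    change w + (((1 - conj (inner ℂ e w)) / (inner ℂ e w - 1) - 1) *
        (((‖e - w‖ : ℝ) : ℂ)⁻¹ * (inner ℂ e w - 1)) * ((‖e - w‖ : ℝ) : ℂ)⁻¹) • (e - w) = e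
    rw [h2]
    simp
  · intro v hev hwv
    rw [inner_smul_left, inner_sub_left, hev, hwv]
    simp

theorem inner_toLpLin_unitary {r : ℕ} (g : U r) (x y : EuclideanSpace ℂ (Fin r)) :
    inner ℂ (Matrix.toLpLin 2 2 (g : Matrix (Fin r) (Fin r) ℂ) x)
      (Matrix.toLpLin 2 2 (g : Matrix (Fin r) (Fin r) ℂ) y) = inner ℂ x y := by
  rw [← star_dotProduct_eq_inner, ← star_dotProduct_eq_inner, Matrix.toLpLin_apply,
    Matrix.toLpLin_apply, star_mulVec_dotProduct, Matrix.mulVec_mulVec,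
    ← star_eq_conjTranspose, Matrix.mem_unitaryGroup_iff'.mp g.2, Matrix.one_mulVec]

/-- The set of complex reflections. -/
def complexReflections (r : ℕ) : Set (U r) :=
  {R | ∃ (u : EuclideanSpace ℂ (Fin r)) (hu : ‖u‖ = 1) (z : Circle), R = complexReflection u hu z}

/-- Here `m` bounds the number of basis vectors not yet known to be fixed. One reflection corrects
the first of them without disturbing the earlier ones, as in triangularisation. -/
theorem mem_closure_complexReflections_of_fix {r : ℕ} (m : ℕ) (g : U r)
    (hg : ∀ i : Fin r, (i : ℕ) + m < r →
      Matrix.toLpLin 2 2 (g : Matrix (Fin r) (Fin r) ℂ) (EuclideanSpace.single i 1) =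
        EuclideanSpace.single i 1) : g ∈ Subgroup.closure (complexReflections r) := by
  induction m generalizing g with
  | zero =>
    have h1 : g = 1 := by
      apply Subtype.ext
      apply (Matrix.toLpLin 2 2).injective
      refine (EuclideanSpace.basisFun (Fin r) ℂ).toBasis.ext fun i => ?_
      simpa [Matrix.toLpLin_one] using hg i i.2
    rw [h1]
    exact one_mem _
  | succ m ih =>
    by_cases hm : m + 1 ≤ r
    · let k : Fin r := ⟨r - (m + 1), by omega⟩
      obtain ⟨u, hu, z, h1, h2⟩ := exists_complexReflection (EuclideanSpace.single k (1 : ℂ))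
        (Matrix.toLpLin 2 2 (g : Matrix (Fin r) (Fin r) ℂ) (EuclideanSpace.single k 1)) (by simp)
        (by
          have h := inner_toLpLin_unitary g (EuclideanSpace.single k 1) (EuclideanSpace.single k 1)
          rw [inner_self_eq_norm_sq_to_K, inner_self_eq_norm_sq_to_K] at h
          have h' : ‖Matrix.toLpLin 2 2 (g : Matrix (Fin r) (Fin r) ℂ)
            (EuclideanSpace.single k 1)‖ ^ 2 = 1 := by
            simpa [← Complex.ofReal_pow] using h
          exact (pow_eq_one_iff_of_nonneg (norm_nonneg _) two_ne_zero).mp h')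
      have h3 : complexReflection u hu z * g ∈ Subgroup.closure (complexReflections r) := by
        refine ih _ fun i hi => ?_
        rw [Submonoid.coe_mul, Matrix.toLpLin_mul_same, LinearMap.comp_apply]
        by_cases hik : i = k
        · rw [hik, h1]
        · have hi' : (i : ℕ) + (m + 1) < r := by
            have : (i : ℕ) ≠ r - (m + 1) := fun e => hik (Fin.ext e)
            omega
          have hik' : inner ℂ (EuclideanSpace.single k (1 : ℂ))
              (EuclideanSpace.single i (1 : ℂ)) = (0 : ℂ) := by
            simp [EuclideanSpace.inner_single_left, Ne.symm hik]
          rw [hg i hi']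
          -- By unitarity of `g`, an already fixed `e_i` is orthogonal to `g e_k` as well as to
          -- `e_k`.
          refine h2 _ hik' ?_
          rw [← hik', ← inner_toLpLin_unitary g (EuclideanSpace.single k 1), hg i hi']
      have h4 : complexReflection u hu z ∈ Subgroup.closure (complexReflections r) :=
        Subgroup.subset_closure ⟨u, hu, z, rfl⟩
      exact (Subgroup.mul_mem_cancel_left _ h4).mp h3
    · exact ih g fun i hi => by omega

theorem closure_complexReflections (r : ℕ) : Subgroup.closure (complexReflections r) = ⊤ :=
  eq_top_iff.mpr fun g _ => mem_closure_complexReflections_of_fix r g fun i hi => by omega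

/-! ### The spin representation is unitary -/

theorem cliffordMap_conjTranspose (r : ℕ) (v : Fin (2 * r) → ℝ) :
    (cliffordMap r v)ᴴ = -cliffordMap r v := by
  simp only [cliffordMap, Fintype.linearCombination_apply, Matrix.conjTranspose_sum,
    ← Finset.sum_neg_distrib]
  refine Finset.sum_congr rfl fun j _ => ?_
  rw [Matrix.conjTranspose_smul, diracMatrix_conjTranspose, star_trivial, smul_neg]

/-- Both sides reverse products, so generators suffice; there `star v = -v` matches skew-Hermitian
matrices. This makes `Spin(2r)` act unitarily. -/
theorem cliffordRep_star (r : ℕ) (x : Cliff (2 * r)) :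
    cliffordRep r (1 ⊗ₜ star x) = (cliffordRep r (1 ⊗ₜ x))ᴴ := by
  have hmul : ∀ x y : Cliff (2 * r), cliffordRep r (1 ⊗ₜ (x * y)) =
      cliffordRep r (1 ⊗ₜ x) * cliffordRep r (1 ⊗ₜ y) := fun x y => by
    rw [← map_mul, Algebra.TensorProduct.tmul_mul_tmul, one_mul]
  induction x using CliffordAlgebra.induction with
  | algebraMap a =>
    have h : (1 : ℂ) ⊗ₜ[ℝ] (algebraMap ℝ (Cliff (2 * r)) a) = (a : ℂ) ⊗ₜ 1 := by
      rw [Algebra.algebraMap_eq_smul_one, TensorProduct.tmul_smul, TensorProduct.smul_tmul']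
      simp
    rw [CliffordAlgebra.star_algebraMap, h, cliffordRep_tmul, ← Algebra.TensorProduct.one_def,
      map_one, Matrix.conjTranspose_smul, Matrix.conjTranspose_one]
    simp
  | ι v =>
    rw [CliffordAlgebra.star_ι, ← map_neg, cliffordRep_ι, cliffordRep_ι, map_neg,
      cliffordMap_conjTranspose]
  | mul x y hx hy => rw [star_mul, hmul, hmul, hx, hy, Matrix.conjTranspose_mul]
  | add x y hx hy =>
    rw [star_add, TensorProduct.tmul_add, TensorProduct.tmul_add, map_add, map_add, hx, hy,
      Matrix.conjTranspose_add]

/-- The matrix by which an element of `Spin(2r)` acts on spinors. -/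
def spinMatrix (r : ℕ) (g : Spin (2 * r)) : Matrix (Fin (2 ^ r)) (Fin (2 ^ r)) ℂ :=
  cliffordRep r (1 ⊗ₜ (g : Cliff (2 * r)))

theorem conjTranspose_spinMatrix_mul (r : ℕ) (g : Spin (2 * r)) :
    (spinMatrix r g)ᴴ * spinMatrix r g = 1 := by
  rw [spinMatrix, ← cliffordRep_star, ← map_mul, Algebra.TensorProduct.tmul_mul_tmul,
    spinGroup.coe_star_mul_self, one_mul, ← Algebra.TensorProduct.one_def, map_one]

theorem spinMatrix_mul_conjTranspose (r : ℕ) (g : Spin (2 * r)) :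
    spinMatrix r g * (spinMatrix r g)ᴴ = 1 :=
  mul_eq_one_comm.mp (conjTranspose_spinMatrix_mul r g)

theorem spinRep_mk (r : ℕ) (g : Spin (2 * r)) (z : Circle) :
    spinRep r (QuotientGroup.mk (g, z)) = Matrix.toLpLin 2 2 ((z : ℂ) • spinMatrix r g) := by
  rw [spinMatrix, ← cliffordRep_tmul]
  rfl

theorem isUnitaryRep_spinRep (r : ℕ) : IsUnitaryRep (spinRep r) := by
  intro s x y
  obtain ⟨⟨g, z⟩, rfl⟩ := QuotientGroup.mk_surjective s
  rw [spinRep_mk, ← star_dotProduct_eq_inner, ← star_dotProduct_eq_inner, Matrix.toLpLin_apply,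
    Matrix.toLpLin_apply, star_mulVec_dotProduct, Matrix.mulVec_mulVec,
    Matrix.conjTranspose_smul, smul_mul_smul_comm, conjTranspose_spinMatrix_mul]
  have h : star (z : ℂ) * z = 1 := by
    rw [Complex.star_def, ← Circle.coe_inv_eq_conj, ← Circle.coe_mul, inv_mul_cancel,
      Circle.coe_one]
  rw [h, one_smul, Matrix.one_mulVec]

/-! ### Lifting the unitary group -/

/-- Compute the square of Clifford multiplication by `v` twice: from the Clifford relation and from
the anticommutation relations. -/
theorem negForm_realCoords (r : ℕ) (v : EuclideanSpace ℂ (Fin r)) :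
    negForm (2 * r) (realCoords r v) = -‖v‖ ^ 2 := by
  have h1 := cliffordMap_sq r (realCoords r v)
  have h2 := annihilation_mul_creation r v v
  have h3 := creation_mul_self r v
  have h4 : (creation r v)ᴴ * (creation r v)ᴴ = 0 := by
    rw [← Matrix.conjTranspose_mul, h3, Matrix.conjTranspose_zero]
  have h5 : cliffordMap r (realCoords r v) * cliffordMap r (realCoords r v) =
      algebraMap ℝ _ (-‖v‖ ^ 2) := by
    rw [cliffordMap_realCoords]
    calc _ = creation r v * creation r v + (creation r v)ᴴ * (creation r v)ᴴ -
          ((creation r v)ᴴ * creation r v + creation r v * (creation r v)ᴴ) := by noncomm_ring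
      _ = _ := by
        rw [h2, h3, h4, inner_self_eq_norm_sq_to_K, Algebra.algebraMap_eq_smul_one,
          ← Complex.coe_smul (-‖v‖ ^ 2)]
        simp
  exact (algebraMap ℝ (Matrix (Fin (2 ^ r)) (Fin (2 ^ r)) ℂ)).injective (h1.symm.trans h5)

theorem ι_mul_ι_mem_spinGroup {n : ℕ} {v w : Fin n → ℝ} (hv : negForm n v = -1)
    (hw : negForm n w = -1) :
    CliffordAlgebra.ι (negForm n) v * CliffordAlgebra.ι (negForm n) w ∈
      spinGroup (negForm n) := by
  have hsq : ∀ {v : Fin n → ℝ}, negForm n v = -1 →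
      CliffordAlgebra.ι (negForm n) v * CliffordAlgebra.ι (negForm n) v = -1 := fun h => by
    rw [CliffordAlgebra.ι_sq_scalar, h, map_neg, map_one]
  let unit : ∀ {v : Fin n → ℝ}, negForm n v = -1 → (Cliff n)ˣ := fun {v} h =>
    ⟨CliffordAlgebra.ι (negForm n) v, -CliffordAlgebra.ι (negForm n) v,
      by rw [mul_neg, hsq h, neg_neg], by rw [neg_mul, hsq h, neg_neg]⟩
  rw [spinGroup.mem_iff, pinGroup.mem_iff]
  refine ⟨⟨⟨unit hv * unit hw, ?_, rfl⟩, ?_⟩, CliffordAlgebra.ι_mul_ι_mem_evenOdd_zero _ _ _⟩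
  · exact mul_mem (Subgroup.subset_closure ⟨v, rfl⟩) (Subgroup.subset_closure ⟨w, rfl⟩)
  · have hu : ∀ {v : Fin n → ℝ}, negForm n v = -1 →
        CliffordAlgebra.ι (negForm n) v ∈ unitary (Cliff n) := fun h => by
      rw [Unitary.mem_iff, CliffordAlgebra.star_ι, neg_mul, mul_neg, hsq h, neg_neg]
      exact ⟨rfl, rfl⟩
    exact mul_mem (hu hv) (hu hw)

/-- The element of `Spin(2r)` over a complex reflection. -/
def reflectionSpin {r : ℕ} (u : EuclideanSpace ℂ (Fin r)) (hu : ‖u‖ = 1) (m : Circle) :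
    Spin (2 * r) :=
  ⟨CliffordAlgebra.ι (negForm (2 * r)) (realCoords r u) *
    CliffordAlgebra.ι (negForm (2 * r))
      (realCoords r (-((m⁻¹ : Circle) : ℂ) • u : EuclideanSpace ℂ (Fin r))),
    ι_mul_ι_mem_spinGroup (by rw [negForm_realCoords, hu]; norm_num)
      (by rw [negForm_realCoords, norm_smul, hu, norm_neg, Circle.norm_coe]; norm_num)⟩

/-- Write `a*` and `a` for creation and annihilation of `u`. Annihilation is antilinear, so `m`
times the second vector acts as `m² a - a*`. Then `(a* - a)(m² a - a*) = m² a* a + a a*`, and `a a*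
= 1 - a* a`. -/
theorem smul_spinMatrix_reflectionSpin {r : ℕ} (u : EuclideanSpace ℂ (Fin r)) (hu : ‖u‖ = 1)
    (m : Circle) : (m : ℂ) • spinMatrix r (reflectionSpin u hu m) =
      1 + (((m ^ 2 : Circle) : ℂ) - 1) • (creation r u * (creation r u)ᴴ) := by
  have h2 := annihilation_mul_creation r u u
  have h3 := creation_mul_self r u
  have h4 : (creation r u)ᴴ * (creation r u)ᴴ = 0 := by
    rw [← Matrix.conjTranspose_mul, h3, Matrix.conjTranspose_zero]
  rw [inner_self_eq_norm_sq_to_K, hu, RCLike.ofReal_one, one_pow, one_smul] at h2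
  have h5 : spinMatrix r (reflectionSpin u hu m) =
      cliffordMap r (realCoords r u) * cliffordMap r (realCoords r
        (-((m⁻¹ : Circle) : ℂ) • u : EuclideanSpace ℂ (Fin r))) := by
    rw [← cliffordRep_ι, ← cliffordRep_ι, ← map_mul, Algebra.TensorProduct.tmul_mul_tmul, one_mul]
    rfl
  have hm : (m : ℂ) * ((m⁻¹ : Circle) : ℂ) = 1 := by
    rw [← Circle.coe_mul, mul_inv_cancel, Circle.coe_one]
  have h6 : (m : ℂ) • cliffordMap r (realCoords r
        (-((m⁻¹ : Circle) : ℂ) • u : EuclideanSpace ℂ (Fin r))) =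
      ((m : ℂ) ^ 2) • (creation r u)ᴴ - creation r u := by
    rw [cliffordMap_realCoords, map_smul, Matrix.conjTranspose_smul, Circle.coe_inv_eq_conj,
      star_neg, Complex.star_def, Complex.conj_conj, smul_sub, smul_smul, smul_smul, mul_neg,
      ← Circle.coe_inv_eq_conj, hm]
    module
  rw [h5, ← mul_smul_comm, h6, cliffordMap_realCoords, mul_sub, sub_mul, sub_mul, mul_smul_comm,
    mul_smul_comm, h3, h4, Circle.coe_pow, ← h2]
  module

theorem one_add_smul_mul_creation {r : ℕ} (u : EuclideanSpace ℂ (Fin r)) (hu : ‖u‖ = 1)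
    (z : Circle) (v : EuclideanSpace ℂ (Fin r)) :
    (1 + ((z : ℂ) - 1) • (creation r u * (creation r u)ᴴ)) * creation r v =
      creation r (Matrix.toLpLin 2 2 (complexReflection u hu z : Matrix (Fin r) (Fin r) ℂ) v) *
        (1 + ((z : ℂ) - 1) • (creation r u * (creation r u)ᴴ)) := by
  have h1 : (creation r u)ᴴ * creation r v = inner ℂ u v • 1 - creation r v * (creation r u)ᴴ :=
    eq_sub_of_add_eq (annihilation_mul_creation r u v)
  have h2 : creation r u * creation r v = -(creation r v * creation r u) :=
    eq_neg_of_add_eq_zero_left (creation_anticomm r u v)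
  have h3 : creation r u * (creation r u * (creation r u)ᴴ) = 0 := by
    rw [← mul_assoc, creation_mul_self, zero_mul]
  rw [toLpLin_complexReflection, map_add, map_smul, add_mul, one_mul, smul_mul_assoc, mul_assoc,
    h1, mul_sub, ← mul_assoc (creation r u), h2, mul_smul_comm, mul_one, mul_add, mul_one,
    add_mul, mul_smul_comm, smul_mul_smul_comm, h3, neg_mul, mul_assoc]
  module

/-- The intertwining relation for single creators extends multiplicatively to the exterior algebra.
-/
theorem one_add_smul_mul_fockHom {r : ℕ} (u : EuclideanSpace ℂ (Fin r)) (hu : ‖u‖ = 1)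
    (z : Circle) (x : Lam r) :
    (1 + ((z : ℂ) - 1) • (creation r u * (creation r u)ᴴ)) * fockHom r x =
      fockHom r (exteriorRep r (complexReflection u hu z) x) *
        (1 + ((z : ℂ) - 1) • (creation r u * (creation r u)ᴴ)) := by
  change _ = fockHom r (ExteriorAlgebra.map _ x) * _
  induction x using ExteriorAlgebra.induction with
  | algebraMap a =>
    rw [AlgHom.commutes, AlgHom.commutes, AlgHom.commutes]
    exact (Algebra.commutes a (1 + ((z : ℂ) - 1) • (creation r u * (creation r u)ᴴ))).symm
  | ι v => rw [ExteriorAlgebra.map_apply_ι, fockHom_ι, fockHom_ι, one_add_smul_mul_creation u hu z]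
  | mul x y hx hy => rw [map_mul, map_mul, map_mul, ← mul_assoc, hx, mul_assoc, hy, mul_assoc]
  | add x y hx hy => rw [map_add, map_add, map_add, mul_add, hx, hy, ← add_mul]

/-- `s ∈ Spin^c(2r)` acts on spinors as `g ∈ U(r)` acts on the exterior algebra, and its
determinant component is `det g`. -/
def Implements (r : ℕ) (s : SpinC (2 * r)) (g : U r) : Prop :=
  (∀ x, spinRep r s (fockMap r x) = fockMap r (exteriorRep r g x)) ∧
    (spinCCover (2 * r) s).2 = detCircle r g

theorem implements_complexReflection {r : ℕ} (u : EuclideanSpace ℂ (Fin r)) (hu : ‖u‖ = 1)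
    (m : Circle) : Implements r (QuotientGroup.mk (reflectionSpin u hu m, m))
      (complexReflection u hu (m ^ 2)) := by
  refine ⟨fun x => ?_, (detCircle_complexReflection u hu (m ^ 2)).symm⟩
  -- After the operator passes `fockHom r x`, it meets the vacuum and acts there as the identity.
  rw [spinRep_mk, smul_spinMatrix_reflectionSpin, fockMap_apply, Matrix.toLpLin_toLp,
    fockMap_apply, Matrix.toLin'_apply, Matrix.mulVec_mulVec, one_add_smul_mul_fockHom u hu,
    ← Matrix.mulVec_mulVec, Matrix.add_mulVec, Matrix.smul_mulVec, ← Matrix.mulVec_mulVec,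
    annihilation_mulVec_vacuum, Matrix.mulVec_zero, smul_zero, add_zero, Matrix.one_mulVec]

theorem Implements.mul {r : ℕ} {s t : SpinC (2 * r)} {g h : U r} (hs : Implements r s g)
    (ht : Implements r t h) : Implements r (s * t) (g * h) := by
  refine ⟨fun x => ?_, ?_⟩
  · rw [map_mul, map_mul, Module.End.mul_apply, Module.End.mul_apply, ht.1, hs.1]
  · rw [map_mul, map_mul, Prod.snd_mul, hs.2, ht.2]

theorem Implements.inv {r : ℕ} {s : SpinC (2 * r)} {g : U r} (hs : Implements r s g) :
    Implements r s⁻¹ g⁻¹ := by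
  refine ⟨fun x => ?_, ?_⟩
  · have h := hs.1 (exteriorRep r g⁻¹ x)
    rw [← Module.End.mul_apply (exteriorRep r g), ← map_mul, mul_inv_cancel, map_one,
      Module.End.one_apply] at h
    rw [← h, ← Module.End.mul_apply, ← map_mul, inv_mul_cancel, map_one, Module.End.one_apply]
  · have h : (spinCCover (2 * r) s).2 * (spinCCover (2 * r) s⁻¹).2 = 1 := by
      rw [← Prod.snd_mul, ← map_mul, mul_inv_cancel, map_one, Prod.snd_one]
    rw [map_inv (detCircle r), ← hs.2]
    exact eq_inv_of_mul_eq_one_right h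

theorem circle_exp_arg_half_sq (z : Circle) : Circle.exp (Complex.arg z / 2) ^ 2 = z := by
  rw [sq, ← Circle.exp_add, add_halves, Circle.exp_arg]

theorem exists_implements (r : ℕ) (g : U r) : ∃ s, Implements r s g := by
  have hg : g ∈ Subgroup.closure (complexReflections r) := by
    rw [closure_complexReflections]; trivial
  induction hg using Subgroup.closure_induction with
  | mem g hg =>
    obtain ⟨u, hu, z, rfl⟩ := hg
    rw [← circle_exp_arg_half_sq z]
    exact ⟨_, implements_complexReflection u hu _⟩
  | one => exact ⟨1, fun x => by simp, by simp⟩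
  | mul g h _ _ hg hh =>
    obtain ⟨s, hs⟩ := hg
    obtain ⟨t, ht⟩ := hh
    exact ⟨_, hs.mul ht⟩
  | inv g _ hg =>
    obtain ⟨s, hs⟩ := hg
    exact ⟨_, hs.inv⟩

/-- Under `fockMap`, left multiplication by `v` in the exterior algebra is creation of `v`, and `g`
acts multiplicatively there. The phase `z` cancels. -/
theorem spinMatrix_mul_creation {r : ℕ} {a : Spin (2 * r)} {z : Circle} {g : U r}
    (h : Implements r (QuotientGroup.mk (a, z)) g) (v : EuclideanSpace ℂ (Fin r)) :
    spinMatrix r a * creation r v =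
      creation r (Matrix.toLpLin 2 2 (g : Matrix (Fin r) (Fin r) ℂ) v) * spinMatrix r a := by
  have hz : (z : ℂ) ≠ 0 := Circle.coe_ne_zero z
  apply smul_right_injective _ hz
  dsimp only
  rw [← smul_mul_assoc, ← mul_smul_comm]
  apply (Matrix.toLpLin 2 2).injective
  refine LinearMap.ext fun y => ?_
  obtain ⟨x, rfl⟩ := fockMap_surjective r y
  have h1 := h.1 (ExteriorAlgebra.ι ℂ v * x)
  have h2 : exteriorRep r g (ExteriorAlgebra.ι ℂ v * x) =
      ExteriorAlgebra.ι ℂ (Matrix.toLpLin 2 2 (g : Matrix (Fin r) (Fin r) ℂ) v) *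
        exteriorRep r g x := by
    change ExteriorAlgebra.map _ _ = _ * ExteriorAlgebra.map _ _
    rw [map_mul, ExteriorAlgebra.map_apply_ι]
  rw [h2, fockMap_mul, fockMap_mul, fockHom_ι, fockHom_ι, ← h.1, spinRep_mk] at h1
  rw [Matrix.toLpLin_mul_same, Matrix.toLpLin_mul_same]
  exact h1

theorem spinMatrix_mul_cliffordMap {r : ℕ} {a : Spin (2 * r)} {z : Circle} {g : U r}
    (h : Implements r (QuotientGroup.mk (a, z)) g) (v : EuclideanSpace ℂ (Fin r)) :
    spinMatrix r a * cliffordMap r (realCoords r v) =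
      cliffordMap r (realCoords r (Matrix.toLpLin 2 2 (g : Matrix (Fin r) (Fin r) ℂ) v)) *
        spinMatrix r a := by
  have h1 := spinMatrix_mul_creation h v
  have h2 : spinMatrix r a * (creation r v)ᴴ =
      (creation r (Matrix.toLpLin 2 2 (g : Matrix (Fin r) (Fin r) ℂ) v))ᴴ * spinMatrix r a := by
    -- Take adjoints and multiply by the unitary spin matrix on both sides to move it across the
    -- annihilators.
    have h3 := congrArg (fun M => spinMatrix r a * Mᴴ * spinMatrix r a) h1
    rw [Matrix.conjTranspose_mul, Matrix.conjTranspose_mul, ← mul_assoc, ← mul_assoc,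
      spinMatrix_mul_conjTranspose, one_mul, mul_assoc, mul_assoc,
      conjTranspose_spinMatrix_mul, mul_one] at h3
    exact h3
  rw [cliffordMap_realCoords, cliffordMap_realCoords, mul_sub, sub_mul, h1, h2]

/-- An element that implements `g` covers `(j(g), det g)`. -/
theorem Implements.spinCCover {r : ℕ} {s : SpinC (2 * r)} {g : U r} (h : Implements r s g) :
    spinCCover (2 * r) s = (realification r g, detCircle r g) := by
  refine Prod.ext ?_ h.2
  obtain ⟨⟨a, z⟩, rfl⟩ := QuotientGroup.mk_surjective s
  change rho (2 * r) a = realification r g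
  refine LinearMap.ext fun v => ?_
  apply cliffordMap_injective r
  obtain ⟨w, rfl⟩ := (realCoords r).surjective v
  have h1 : realification r g (realCoords r w) = realCoords r
      (Matrix.toLpLin 2 2 (g : Matrix (Fin r) (Fin r) ℂ) (WithLp.toLp 2 w)) := by
    simp [realification, LinearEquiv.conj_apply]
  have h2 := spinMatrix_mul_cliffordMap h (WithLp.toLp 2 w)
  rw [h1, ← cliffordRep_ι, ι_rho]
  have h3 : cliffordRep r (1 ⊗ₜ ((a : Cliff (2 * r)) *
      CliffordAlgebra.ι (negForm (2 * r)) (realCoords r w) * (a⁻¹ : Spin (2 * r)))) =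
      spinMatrix r a * cliffordMap r (realCoords r w) * (spinMatrix r a)ᴴ := by
    rw [spinMatrix, ← cliffordRep_star, ← cliffordRep_ι, ← map_mul, ← map_mul,
      Algebra.TensorProduct.tmul_mul_tmul, Algebra.TensorProduct.tmul_mul_tmul, one_mul, one_mul]
    rfl
  rw [h3]
  have h4 := congrArg (· * (spinMatrix r a)ᴴ) h2
  dsimp only at h4
  rw [mul_assoc (cliffordMap r _), spinMatrix_mul_conjTranspose, mul_one] at h4
  exact h4

/-! ### The kernel of the covering -/

theorem eq_one_or_neg_one_of_spinCCover_eq_one {r : ℕ} {a : Spin (2 * r)} {z : Circle}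
    (h : spinCCover (2 * r) (QuotientGroup.mk (a, z)) = 1) :
    ((a : Cliff (2 * r)) = 1 ∨ (a : Cliff (2 * r)) = -1) ∧ z ^ 2 = 1 := by
  have h1 : rho (2 * r) a = 1 := congrArg Prod.fst h
  refine ⟨spin_eq_one_or_neg_one r a fun v => ?_, congrArg Prod.snd h⟩
  have h2 := ι_rho a v
  rw [h1, Module.End.one_apply] at h2
  have h3 : ((a⁻¹ : Spin (2 * r)) : Cliff (2 * r)) * a = 1 :=
    congrArg (fun x : Spin (2 * r) => (x : Cliff (2 * r))) (inv_mul_cancel a)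
  conv_rhs => rw [h2, mul_assoc, h3, mul_one]

theorem mul_self_of_spinCCover_eq_one {r : ℕ} {s : SpinC (2 * r)}
    (h : spinCCover (2 * r) s = 1) : s * s = 1 := by
  obtain ⟨⟨a, z⟩, rfl⟩ := QuotientGroup.mk_surjective s
  obtain ⟨ha, hz⟩ := eq_one_or_neg_one_of_spinCCover_eq_one h
  have h1 : a * a = 1 := Subtype.ext (by
    rcases ha with ha | ha <;> simp [ha])
  rw [← QuotientGroup.mk_mul, Prod.mk_mul_mk, h1, ← sq, hz]
  rfl

theorem commute_of_spinCCover_eq_one {r : ℕ} {s : SpinC (2 * r)}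
    (h : spinCCover (2 * r) s = 1) (t : SpinC (2 * r)) : s * t = t * s := by
  obtain ⟨⟨a, z⟩, rfl⟩ := QuotientGroup.mk_surjective s
  obtain ⟨⟨b, w⟩, rfl⟩ := QuotientGroup.mk_surjective t
  obtain ⟨ha, -⟩ := eq_one_or_neg_one_of_spinCCover_eq_one h
  have h1 : a * b = b * a := Subtype.ext (by
    rcases ha with ha | ha <;> simp [ha])
  rw [← QuotientGroup.mk_mul, ← QuotientGroup.mk_mul, Prod.mk_mul_mk, Prod.mk_mul_mk, h1,
    mul_comm z w]

/-- The kernel of the covering consists of classes of sign pairs; acting trivially on spinors forces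
the two signs to agree. -/
theorem eq_one_of_spinRep_eq_one {r : ℕ} {s : SpinC (2 * r)}
    (h : spinCCover (2 * r) s = 1) (h' : spinRep r s = 1) : s = 1 := by
  obtain ⟨⟨a, z⟩, rfl⟩ := QuotientGroup.mk_surjective s
  obtain ⟨ha, -⟩ := eq_one_or_neg_one_of_spinCCover_eq_one h
  rw [spinRep_mk] at h'
  have h1 : (z : ℂ) • spinMatrix r a = 1 := by
    apply (Matrix.toLpLin 2 2).injective
    rw [h', Matrix.toLpLin_one]
    rfl
  have hinj : ∀ w : ℂ, w • (1 : Matrix (Fin (2 ^ r)) (Fin (2 ^ r)) ℂ) = 1 → w = 1 := fun w hw => by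
    simpa using congrFun (congrFun hw 0) 0
  have hone : cliffordRep r (1 ⊗ₜ 1) = 1 := by
    rw [← Algebra.TensorProduct.one_def, map_one]
  rw [QuotientGroup.eq_one_iff]
  rcases ha with ha | ha
  · refine Or.inl ⟨ha, hinj _ ?_⟩
    rw [spinMatrix, ha, hone] at h1
    exact h1
  · refine Or.inr ⟨ha, neg_eq_iff_eq_neg.mp (hinj _ ?_)⟩
    rw [spinMatrix, ha, TensorProduct.tmul_neg, map_neg, hone, smul_neg, ← neg_smul] at h1
    exact h1

/-! ### The canonical lift -/

/-- The quotient of two implementers implements `1`, so it is trivial both in the covering and on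
spinors. -/
theorem Implements.unique {r : ℕ} {s t : SpinC (2 * r)} {g : U r} (hs : Implements r s g)
    (ht : Implements r t g) : s = t := by
  have h := hs.mul ht.inv
  rw [mul_inv_cancel] at h
  rw [← mul_inv_eq_one]
  refine eq_one_of_spinRep_eq_one ?_ ?_
  · rw [h.spinCCover, map_one, map_one]
    rfl
  · refine LinearMap.ext fun y => ?_
    obtain ⟨x, rfl⟩ := fockMap_surjective r y
    rw [h.1, map_one]
    rfl

/-- The canonical homomorphism `U(r) → Spin^c(2r)`. -/
def canonicalLift (r : ℕ) : U r →* SpinC (2 * r) where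
  toFun g := (exists_implements r g).choose
  map_one' := (exists_implements r 1).choose_spec.unique ⟨fun x => by simp, by simp⟩
  map_mul' g h := (exists_implements r (g * h)).choose_spec.unique
    ((exists_implements r g).choose_spec.mul (exists_implements r h).choose_spec)

theorem canonicalLift_implements (r : ℕ) (g : U r) : Implements r (canonicalLift r g) g :=
  (exists_implements r g).choose_spec

theorem canonicalLift_isLift (r : ℕ) : IsLift r (canonicalLift r) := fun g =>
  (canonicalLift_implements r g).spinCCover

theorem IsLift.unique {r : ℕ} {f f' : U r →* SpinC (2 * r)} (hf : IsLift r f)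
    (hf' : IsLift r f') : f' = f := by
  refine MonoidHom.eq_of_eqOn_dense (closure_complexReflections r) ?_
  rintro _ ⟨u, hu, z, rfl⟩
  -- Write the reflection as the square of one with the same axis. The two lifts differ at the root
  -- by a central element `k` with `k² = 1`, which disappears on squaring.
  rw [← circle_exp_arg_half_sq z, sq, ← complexReflection_mul, map_mul, map_mul]
  set g := complexReflection u hu (Circle.exp (Complex.arg z / 2))
  have h1 : spinCCover (2 * r) (f' g * (f g)⁻¹) = 1 := by
    rw [map_mul, hf' g, ← hf g, ← map_mul, mul_inv_cancel, map_one]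
  have h2 : f' g = f' g * (f g)⁻¹ * f g := by rw [inv_mul_cancel_right]
  generalize f' g * (f g)⁻¹ = k at h1 h2
  rw [h2, mul_assoc, ← mul_assoc (f g), ← commute_of_spinCCover_eq_one h1, ← mul_assoc,
    ← mul_assoc, mul_self_of_spinCCover_eq_one h1, one_mul]

/-! ### Continuity of the lift -/

theorem continuous_fockHom_exteriorRep (r : ℕ) (x : Lam r) :
    Continuous fun g : U r => fockHom r (exteriorRep r g x) := by
  change Continuous fun g : U r => fockHom r (ExteriorAlgebra.map
    (Matrix.toLpLin 2 2 (g : Matrix (Fin r) (Fin r) ℂ)) x)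
  induction x using ExteriorAlgebra.induction with
  | algebraMap a =>
    simp only [AlgHom.commutes]
    exact continuous_const
  | ι v =>
    simp only [ExteriorAlgebra.map_apply_ι, fockHom_ι]
    have h1 : Continuous (creation r) := LinearMap.continuous_of_finiteDimensional _
    refine h1.comp ?_
    have h2 : Continuous fun M : Matrix (Fin r) (Fin r) ℂ => Matrix.toLpLin 2 2 M v :=
      LinearMap.continuous_of_finiteDimensional
        ((LinearMap.applyₗ v : _ →ₗ[ℂ] EuclideanSpace ℂ (Fin r)) ∘ₗ
          (Matrix.toLpLin 2 2 : Matrix (Fin r) (Fin r) ℂ ≃ₗ[ℂ] _).toLinearMap)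
    exact h2.comp continuous_subtype_val
  | mul x y hx hy =>
    simp only [map_mul]
    exact hx.mul hy
  | add x y hx hy =>
    simp only [map_add]
    exact hx.add hy

theorem continuous_spinRep_canonicalLift (r : ℕ) :
    Continuous fun g : U r => (Matrix.toLpLin 2 2 : Matrix (Fin (2 ^ r)) (Fin (2 ^ r)) ℂ ≃ₗ[ℂ] _).symm
      (spinRep r (canonicalLift r g)) := by
  refine continuous_matrix fun i j => ?_
  obtain ⟨x, hx⟩ := fockMap_surjective r (EuclideanSpace.single j 1)
  have h : ∀ g : U r, (Matrix.toLpLin 2 2 : Matrix (Fin (2 ^ r)) (Fin (2 ^ r)) ℂ ≃ₗ[ℂ] _).symm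
      (spinRep r (canonicalLift r g)) i j =
        (fockHom r (exteriorRep r g x) *ᵥ vacuum r) i := by
    intro g
    have h1 := (canonicalLift_implements r g).1 x
    obtain ⟨M, hM⟩ := (Matrix.toLpLin 2 2 : Matrix (Fin (2 ^ r)) (Fin (2 ^ r)) ℂ ≃ₗ[ℂ]
      (EuclideanSpace ℂ (Fin (2 ^ r)) →ₗ[ℂ] EuclideanSpace ℂ (Fin (2 ^ r)))).surjective
      (spinRep r (canonicalLift r g))
    rw [← hM, hx] at h1
    rw [← hM, LinearEquiv.symm_apply_apply]
    have h2 := congrArg (fun y : EuclideanSpace ℂ (Fin (2 ^ r)) => y i) h1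
    simpa [fockMap_apply, Matrix.toLpLin_apply] using h2
  simp only [h]
  exact (continuous_apply i).comp
    ((continuous_fockHom_exteriorRep r x).matrix_mulVec continuous_const)

theorem continuous_detCircle (r : ℕ) : Continuous (detCircle r) :=
  Continuous.subtype_mk (Continuous.matrix_det continuous_subtype_val) _

/-- Multiply a fixed root of `det g₀` by the principal root of `det g / det g₀`. That quotient is
`1` at `g₀`, away from the cut of `arg`. -/
theorem exists_continuousAt_sq_eq_detCircle (r : ℕ) (g₀ : U r) :
    ∃ m : U r → Circle, ContinuousAt m g₀ ∧ ∀ g, m g ^ 2 = detCircle r g := by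
  refine ⟨fun g => Circle.exp (Complex.arg (detCircle r g₀) / 2) *
    Circle.exp (Complex.arg ((detCircle r g₀)⁻¹ * detCircle r g : Circle) / 2), ?_, fun g => ?_⟩
  · refine continuousAt_const.mul (Circle.exp.continuous.continuousAt.comp ?_)
    refine ContinuousAt.div_const ?_ 2
    have h1 : Continuous fun g => (((detCircle r g₀)⁻¹ * detCircle r g : Circle) : ℂ) :=
      continuous_subtype_val.comp (continuous_const.mul (continuous_detCircle r))
    refine ContinuousAt.comp (g := Complex.arg) (Complex.continuousAt_arg ?_) h1.continuousAt
    simp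
  · rw [mul_pow, circle_exp_arg_half_sq, circle_exp_arg_half_sq, mul_inv_cancel_left]

theorem neg_one_mem_spinGroup {r : ℕ} (hr : 1 ≤ r) :
    (-1 : Cliff (2 * r)) ∈ spinGroup (negForm (2 * r)) := by
  have h : negForm (2 * r) (realCoords r (EuclideanSpace.single (⟨0, hr⟩ : Fin r) (1 : ℂ))) =
      -1 := by
    rw [negForm_realCoords]
    simp
  have h' := ι_mul_ι_mem_spinGroup h h
  rwa [CliffordAlgebra.ι_sq_scalar, h, map_neg, map_one] at h'

/-- Two square roots differ by a sign, which can be moved into the `Spin` factor because `-1` lies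
there. -/
theorem exists_mk_eq {r : ℕ} (hr : 1 ≤ r) (s : SpinC (2 * r)) (m : Circle)
    (h : (spinCCover (2 * r) s).2 = m ^ 2) : ∃ a : Spin (2 * r), QuotientGroup.mk (a, m) = s := by
  obtain ⟨⟨b, w⟩, rfl⟩ := QuotientGroup.mk_surjective s
  replace h : w ^ 2 = m ^ 2 := h
  have h' : (w : ℂ) ^ 2 = (m : ℂ) ^ 2 := by rw [← Circle.coe_pow, h, Circle.coe_pow]
  rcases sq_eq_sq_iff_eq_or_eq_neg.mp h' with e | e
  · exact ⟨b, by rw [Circle.ext e]⟩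
  · refine ⟨b * ⟨-1, neg_one_mem_spinGroup hr⟩, Eq.symm ?_⟩
    rw [QuotientGroup.eq]
    right
    constructor
    · simp
    · have hm : (m : ℂ) ≠ 0 := Circle.coe_ne_zero m
      simp [e, hm]

theorem continuous_canonicalLift {r : ℕ} (hr : 1 ≤ r) : Continuous (canonicalLift r) := by
  rw [continuous_iff_continuousAt]
  intro g₀
  obtain ⟨m, hm, hsq⟩ := exists_continuousAt_sq_eq_detCircle r g₀
  choose a ha using fun g => exists_mk_eq hr (canonicalLift r g) (m g)
    (by rw [(canonicalLift_implements r g).2, hsq])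
  -- Removing the phase `m g` leaves the matrix of `1 ⊗ a g`, from which the linear map `cliffPart`
  -- recovers `a g` continuously.
  have h1 : ∀ g, (a g : Cliff (2 * r)) = cliffPart r (((m g)⁻¹ : Circle) •
      (Matrix.toLpLin 2 2 : Matrix (Fin (2 ^ r)) (Fin (2 ^ r)) ℂ ≃ₗ[ℂ] _).symm
        (spinRep r (canonicalLift r g))) := by
    intro g
    rw [← ha, spinRep_mk, LinearEquiv.symm_apply_apply, Circle.smul_def, smul_smul,
      ← Circle.coe_mul, inv_mul_cancel, Circle.coe_one, one_smul, spinMatrix,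
      cliffPart_cliffordRep, Complex.one_re, one_smul]
  have h2 : ContinuousAt a g₀ := by
    rw [Topology.IsInducing.subtypeVal.continuousAt_iff]
    exact ((continuous_cliffPart r).continuousAt.comp (hm.inv.smul
      (continuous_spinRep_canonicalLift r).continuousAt)).congr (.of_forall fun g => (h1 g).symm)
  have h4 : (canonicalLift r : U r → SpinC (2 * r)) = fun g => QuotientGroup.mk (a g, m g) :=
    funext fun g => (ha g).symm
  rw [h4]
  exact QuotientGroup.continuous_mk.continuousAt.comp (h2.prodMk hm)

/-! ### Unitary equivalence with the exterior algebra -/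

/-- Unitarity is transported from the spin representation through `fockEquiv`, avoiding minors of
`g`. -/
theorem isUnitaryRep_exteriorRep (r : ℕ) : IsUnitaryRep (exteriorRep r) := by
  intro g x y
  rw [← (fockEquiv r).inner_map_map, fockEquiv_apply, fockEquiv_apply,
    ← (canonicalLift_implements r g).1, ← (canonicalLift_implements r g).1,
    isUnitaryRep_spinRep r, ← fockEquiv_apply, ← fockEquiv_apply, (fockEquiv r).inner_map_map]

theorem unitarilyEquivalent_exteriorRep (r : ℕ) :
    UnitarilyEquivalent ((spinRep r).comp (canonicalLift r)) (exteriorRep r) := by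
  refine ⟨fun g => isUnitaryRep_spinRep r (canonicalLift r g), isUnitaryRep_exteriorRep r,
    (fockEquiv r).symm, fun g v => ?_⟩
  obtain ⟨x, rfl⟩ := (fockEquiv r).surjective v
  rw [LinearIsometryEquiv.symm_apply_apply, LinearIsometryEquiv.symm_apply_eq, fockEquiv_apply,
    fockEquiv_apply]
  exact (canonicalLift_implements r g).1 x

end SpinorRep

end

theorem mainTheorem12 (r : ℕ) (hr : 1 ≤ r) :
    ∃ f : SpinorRep.U r →* SpinorRep.SpinC (2 * r),
      Continuous f ∧ SpinorRep.IsLift r f ∧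
      (∀ f' : SpinorRep.U r →* SpinorRep.SpinC (2 * r), SpinorRep.IsLift r f' → f' = f) ∧
      SpinorRep.UnitarilyEquivalent ((SpinorRep.spinRep r).comp f) (SpinorRep.exteriorRep r) :=
  ⟨SpinorRep.canonicalLift r, SpinorRep.continuous_canonicalLift hr,
    SpinorRep.canonicalLift_isLift r, fun _ hf' => (SpinorRep.canonicalLift_isLift r).unique hf',
    SpinorRep.unitarilyEquivalent_exteriorRep r⟩
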